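/- All Lie algebras are finite-dimensional over $\mathbb{C}$. Write $C^1\mathfrak g=\mathfrak g$, $C^{k}\mathfrak g=[C^{k-1}\mathfrak g,\mathfrak g]$ and $D^0\mathfrak g=\mathfrak g$, $D^k\mathfrak g=[D^{k-1}\mathfrak g,D^{k-1}\mathfrak g]$; the derived length of a solvable $\mathfrak g$ is the least $m$ with $D^m\mathfrak g=0$. An $n$-dimensional Lie algebra $\mathfrak g$ is filiform if $\dim C^k\mathfrak g=n-k$ for $2\le k\le n$. A basis $e_1,\dots,e_n$ of a filiform $\mathfrak g$ is adapted if $[e_1,e_h]=e_{h-1}$ for $3\le h\le n$, $[e_2,e_h]=0$ for $1\le h\le n$, and $[e_3,e_h]=0$ for $2\le h\le n$; $P_h(u)$ denotes the coefficient of $e_h$ in $u$. The algebra is model if, in an adapted basis, the only nonzero brackets of basis vectors are $[e_1,e_h]=e_{h-1}$ ($3\le h\le n$), up to antisymmetry. For a non-model filiform $\mathfrak g$ put, in an adapted basis, $$z_1=\min\{k\ge4 : [e_k,e_n]\ne0\},\qquad z_2=\min\{k\ge4 : [e_k,e_{k+1}]\ne0\}.$$ Let $\mathcal F_{\alpha\gamma}$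 (for the triple $(z_1,z_2,n)$) be the family of $n$-dimensional non-model filiform Lie algebras having an adapted basis in which the invariants are $z_1,z_2$ and, for some complex numbers $\alpha_i,\gamma_j,\beta_{k\ell}$, $$[e_{z_1+i},e_{z_2+1}]=\alpha_1e_{i+2}+\alpha_2e_{i+1}+\dots+\alpha_{i+1}e_2\quad(0\le i\le z_2-z_1),$$ $$[e_{z_1},e_{z_2+j}]=\alpha_1e_{j+1}+\gamma_1e_j+\dots+\gamma_{j-1}e_2\quad(2\le j\le n-z_2),$$ $$[e_{z_1+k},e_{z_2+\ell}]=\sum_{h=2}^{k+\ell}P_h\big([e_{z_1+k-1},e_{z_2+\ell}]+[e_{z_1+k},e_{z_2+\ell-1}]\big)e_{h+1}+\beta_{k\ell}e_2\quad(2\le\ell\le n-z_2,\ 1\le k<z_2-z_1+\ell)$$ (with $e_{h}=0$ and $P_h=0$ for $h>n$), where $\beta_{k\ell}=\gamma_{k+\ell-1}$ whenever $k+\ell\le n-z_2$. Theorem. (1) Every Lie algebra in $\mathcal F_{\alpha\gamma}$ is solvable of derived length at most $3$; more precisely, its derived length is $2$ if $z_2=n-1$ and $3$ otherwise. (2) If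 $4\le z_1\le 2(n-z_2)-4$ and $z_2\le n-3$, then $\mathcal F_{\alpha\gamma}$ for the triple $(z_1,z_2,n)$ is empty. -/

import Mathlib

noncomputable section

namespace FiliformLie

variable {𝔤 : Type*} [LieRing 𝔤] [LieAlgebra ℂ 𝔤]

/-- The `k`-th term `C^k 𝔤` of the descending central series, numbered from `C^1 𝔤 = 𝔤`,
so that `C^(k+1) 𝔤 = [C^k 𝔤, 𝔤]`. Only used for `k ≥ 1`. -/
def descCentral (𝔤 : Type*) [LieRing 𝔤] [LieAlgebra ℂ 𝔤] (k : ℕ) : LieSubmodule ℂ 𝔤 𝔤 :=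
  LieModule.lowerCentralSeries ℂ 𝔤 𝔤 (k - 1)

/-- `𝔤` is a filiform Lie algebra of dimension `n`: `dim C^k 𝔤 = n - k` for `2 ≤ k ≤ n`. -/
structure IsFiliform (𝔤 : Type*) [LieRing 𝔤] [LieAlgebra ℂ 𝔤] (n : ℕ) : Prop where
  finite : FiniteDimensional ℂ 𝔤
  finrank_eq : Module.finrank ℂ 𝔤 = n
  finrank_descCentral : ∀ k, 2 ≤ k → k ≤ n → Module.finrank ℂ (descCentral 𝔤 k) = n - k

/-- The basis vectors numbered `e_1, …, e_n` (and `0` for an index outside `1, …, n`). -/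
def basisVec {n : ℕ} (b : Module.Basis (Fin n) ℂ 𝔤) (i : ℕ) : 𝔤 :=
  if h : 1 ≤ i ∧ i ≤ n then b ⟨i - 1, by omega⟩ else 0

/-- The coordinate functional `P_h`, for `1 ≤ h ≤ n`: the coefficient of `e_h`
(and `0` for an index outside `1, …, n`). -/
def coordFun {n : ℕ} (b : Module.Basis (Fin n) ℂ 𝔤) (h : ℕ) : 𝔤 →ₗ[ℂ] ℂ :=
  if hh : 1 ≤ h ∧ h ≤ n then b.coord ⟨h - 1, by omega⟩ else 0

/-- Adapted bases:
`[e_1, e_h] = e_(h-1)` for `3 ≤ h ≤ n`, `[e_2, e_h] = 0` for `1 ≤ h ≤ n`, and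
`[e_3, e_h] = 0` for `2 ≤ h ≤ n`. -/
structure IsAdapted {n : ℕ} (b : Module.Basis (Fin n) ℂ 𝔤) : Prop where
  bracket_one : ∀ h, 3 ≤ h → h ≤ n → ⁅basisVec b 1, basisVec b h⁆ = basisVec b (h - 1)
  bracket_two : ∀ h, 1 ≤ h → h ≤ n → ⁅basisVec b 2, basisVec b h⁆ = 0
  bracket_three : ∀ h, 2 ≤ h → h ≤ n → ⁅basisVec b 3, basisVec b h⁆ = 0

/-- `𝔤` is a model filiform Lie algebra of dimension `n`: for an adapted basis, the only nonzero
brackets of basis vectors are `[e_1, e_h] = e_(h-1)`, `3 ≤ h ≤ n`. -/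
def IsModel (𝔤 : Type*) [LieRing 𝔤] [LieAlgebra ℂ 𝔤] (n : ℕ) : Prop :=
  IsFiliform 𝔤 n ∧ ∃ b : Module.Basis (Fin n) ℂ 𝔤, IsAdapted b ∧
    ∀ i j, 2 ≤ i → i ≤ n → 2 ≤ j → j ≤ n → ⁅basisVec b i, basisVec b j⁆ = 0

/-- The two numerical invariants, computed in an adapted basis:
`z₁ = min {k ≥ 4 | [e_k, e_n] ≠ 0}` and `z₂ = min {k ≥ 4 | [e_k, e_(k+1)] ≠ 0}`. -/
structure HasTriple {n : ℕ} (b : Module.Basis (Fin n) ℂ 𝔤) (z₁ z₂ : ℕ) : Prop where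
  isLeast_one : IsLeast {k : ℕ | 4 ≤ k ∧ k ≤ n ∧ ⁅basisVec b k, basisVec b n⁆ ≠ 0} z₁
  isLeast_two :
    IsLeast {k : ℕ | 4 ≤ k ∧ k + 1 ≤ n ∧ ⁅basisVec b k, basisVec b (k + 1)⁆ ≠ 0} z₂

/-- The law with parameters `α_i`, `β_(k,ℓ)`, `γ_j` in the basis `e_1, …, e_n`. The brackets
`[e_1, e_h]` are given by adaptedness; brackets of basis vectors that are not listed
are zero once `b` is adapted with triple `(z₁, z₂, n)`. Only the values of `α`, `β`, `γ` in the
index ranges below matter. -/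
structure HasLaw {n : ℕ} (b : Module.Basis (Fin n) ℂ 𝔤) (z₁ z₂ : ℕ)
    (α : ℕ → ℂ) (β : ℕ → ℕ → ℂ) (γ : ℕ → ℂ) : Prop where
  law_alpha : ∀ i, z₁ + i ≤ z₂ →
    ⁅basisVec b (z₁ + i), basisVec b (z₂ + 1)⁆ =
      ∑ s ∈ Finset.range (i + 1), α (s + 1) • basisVec b (i + 2 - s)
  law_gamma : ∀ j, 2 ≤ j → z₂ + j ≤ n →
    ⁅basisVec b z₁, basisVec b (z₂ + j)⁆ =
      α 1 • basisVec b (j + 1) + ∑ s ∈ Finset.Icc 1 (j - 1), γ s • basisVec b (j + 1 - s)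
  law_beta : ∀ k l, 2 ≤ l → z₂ + l ≤ n → 1 ≤ k → z₁ + k < z₂ + l →
    ⁅basisVec b (z₁ + k), basisVec b (z₂ + l)⁆ =
      ∑ h ∈ Finset.Icc 2 (k + l),
        coordFun b h (⁅basisVec b (z₁ + k - 1), basisVec b (z₂ + l)⁆ +
          ⁅basisVec b (z₁ + k), basisVec b (z₂ + l - 1)⁆) • basisVec b (h + 1) +
      β k l • basisVec b 2

/-- `𝔤` belongs to the family `F_(αγ)` attached to the triple `(z₁, z₂, n)`: it is a non-model
filiform Lie algebra of dimension `n` with this triple whose law, in some adapted basis, has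
parameters with `β_(k,ℓ) = γ_(k+ℓ-1)` whenever `k + ℓ ≤ n - z₂`. -/
def MemFamilyAlphaGamma (𝔤 : Type*) [LieRing 𝔤] [LieAlgebra ℂ 𝔤] (z₁ z₂ n : ℕ) : Prop :=
  IsFiliform 𝔤 n ∧ ¬ IsModel 𝔤 n ∧
    ∃ b : Module.Basis (Fin n) ℂ 𝔤, IsAdapted b ∧ HasTriple b z₁ z₂ ∧
      ∃ (α : ℕ → ℂ) (β : ℕ → ℕ → ℂ) (γ : ℕ → ℂ), HasLaw b z₁ z₂ α β γ ∧
        ∀ k l, 2 ≤ l → z₂ + l ≤ n → 1 ≤ k → z₁ + k < z₂ + l → z₂ + k + l ≤ n →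
          β k l = γ (k + l - 1)

end FiliformLie

end

/-!
Write a non-model algebra of the family in its adapted basis and call `i + j` the weight of the
bracket `[e_i, e_j]`. Since `[e_1, ·]` is a derivation that lowers indices by one, every structure
constant is determined by coefficients of `e_2` through Pascal's rule (`StructureConstants.step`).
Let `w = z₁ + z₂ + m` be the lowest weight in which `e_2` occurs. Then `[e_i, e_j]` has no
component at `e_h` for `h > i + j - w + 2`, and the leading coefficients, those at
`h = i + j - w + 2`, form in the coordinates `x = i - z₂`, `y = j - z₂` a `BallotGrid`: a Pascal
triangle that is alternating in `(x, y)`. The condition `β_(k,ℓ) = γ_(k+ℓ-1)` says that its initial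
values on the line `x + y = const` are a constant `u` in the rows `2, …, m`, one further value `v`
in the row `1`, and `0` elsewhere. The coefficient of `e_2` in the Jacobi identity of weight
`2 w - 2` involves these numbers only (`StructureConstants.jacobi_leading`).

For part (2), suppose `z₁ + 4 ≤ 2 (n - z₂)`.

* If `u ≠ 0`, normalise `u = 1`. Unless `v` is a negative real number, a real functional makes
  both `1` and `v` nonnegative (`JacobiGrid.exists_functional_or_neg`), so that all relevant
  entries become positive and rows become monotone; this contradicts two or three well chosen Jacobi
  identities. If `v < 0`, positivity is replaced by a sign pattern: nonpositive entries
  propagate towards the diagonal (`BallotGrid.nonpos_neighbours`). Which triples of indices are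
  used depends on the position of `z₁` relative to `2 m`; the cases are joined in
  `JacobiGrid.false_of_complex`.
* If `u = 0`, the grid has the single source `v ≠ 0`, and its relevant entries are nonzero
  multiples of `v`. The leading Jacobi identities then bound `z₁` from below, and the Jacobi
  identities pairing the leading grid with the first later weight in which `[e_{z₁}, ·]` reaches
  `e_2` give the contradiction (`BallotGrid.false_of_single`).

For part (1), the same estimates without the hypothesis on `z₁` show that `z₁` is large unless
`z₂ = n - 1`; hence the brackets of the `e_i` with `i < n` lie in the span of `e_2, …, e_{z₂}`
(`StructureConstants.zero_of_lt_of_lt`). That span contains `D^2` and is abelian, so `D^3 = 0`,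
while `0 ≠ [e_{z₂}, e_{z₂+1}]` lies in `D^2`. If `z₂ = n - 1`, already `D^1` lies in this span.
-/

namespace FiliformLie

/-! ### Ballot grids -/

/-- A *ballot grid* with source `s`: for `x < y` in the half-plane `1 - g < x + y`, the entry
`G x y` is the sum of its two neighbours `G (x - 1) y` and `G x (y - 1)`; it vanishes on the
diagonal and takes the values `s y` on the boundary line `x + y = 1 - g`. Only the
rows `y ≤ r` are considered. -/
structure BallotGrid {A : Type*} [AddCommGroup A] (g r : ℤ) (s : ℤ → A) (G : ℤ → ℤ → A) : Prop where
  diag : ∀ x, G x x = 0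
  step : ∀ x y, x < y → y ≤ r → 1 - g < x + y → G x y = G (x - 1) y + G x (y - 1)
  init : ∀ x y, x < y → y ≤ r → x + y = 1 - g → G x y = s y

/-- The source with value `v` at `1`, value `u` at `2, …, m`, and `0` elsewhere. -/
def stepSource {A : Type*} [Zero A] (m : ℤ) (u v : A) (y : ℤ) : A :=
  if y = 1 then v else if 2 ≤ y ∧ y ≤ m then u else 0

namespace BallotGrid

theorem map {A B : Type*} [AddCommGroup A] [AddCommGroup B] {g r m : ℤ} {u v : A} {G : ℤ → ℤ → A}
    (hG : BallotGrid g r (stepSource m u v) G) (f : A →+ B) :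
    BallotGrid g r (stepSource m (f u) (f v)) (fun x y => f (G x y)) where
  diag x := by simp [hG.diag]
  step x y h1 h2 h3 := by simp [hG.step x y h1 h2 h3]
  init x y h1 h2 h3 := by
    simp only [hG.init x y h1 h2 h3, stepSource]
    split_ifs <;> simp

/-- The last two entries of a row agree, because the grid vanishes on the diagonal. -/
theorem pred_eq {A : Type*} [AddCommGroup A] {g r : ℤ} {s : ℤ → A} {G : ℤ → ℤ → A}
    (hG : BallotGrid g r s G) (y : ℤ) (hy : y ≤ r) (h : 2 - g < 2 * y) :
    G (y - 1) y = G (y - 2) y := by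
  have := hG.step (y - 1) y (by omega) hy (by omega)
  rw [hG.diag, add_zero] at this
  rw [this]; congr 1; ring

variable {g r m : ℤ} {u v : ℝ} {G : ℤ → ℤ → ℝ}

/-- The source at `1` is only visible from the columns `-g ≤ x`, so its sign is irrelevant to the
left of them. -/
theorem nonneg (hG : BallotGrid g r (stepSource m u v) G) (hu : 0 ≤ u) {x y : ℤ}
    (hv : x ≤ -g - 1 ∨ 0 ≤ v) (hxy : x ≤ y) (hy : y ≤ r) (hN : 1 - g ≤ x + y) : 0 ≤ G x y := by
  obtain ⟨N, hN⟩ : ∃ N : ℕ, x + y = 1 - g + N := ⟨(x + y - (1 - g)).toNat, by omega⟩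
  induction N generalizing x y with
  | zero =>
    rcases hxy.eq_or_lt with rfl | hlt
    · rw [hG.diag]
    rw [hG.init x y hlt hy (by simpa using hN), stepSource]
    split_ifs with h1 h2
    · rcases hv with hv | hv
      · push_cast at hN; omega
      · exact hv
    · exact hu
    · exact le_rfl
  | succ N ih =>
    rcases hxy.eq_or_lt with rfl | hlt
    · rw [hG.diag]
    rw [hG.step x y hlt hy (by push_cast at hN; omega)]
    refine add_nonneg (ih ?_ (by omega) hy (by push_cast at hN; omega) (by push_cast at hN; omega))
      (ih hv (by omega) (by omega) (by push_cast at hN; omega) (by push_cast at hN; omega))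
    rcases hv with hv | hv
    · left; omega
    · exact .inr hv

theorem pos (hG : BallotGrid g r (stepSource m u v) G) (hu : 0 < u) (hg : 0 ≤ g) (hm : 2 ≤ m)
    {x y : ℤ} (hv : x ≤ -g - 1 ∨ 0 ≤ v) (hxy : x < y) (hy : y ≤ r) (hN : 1 - g ≤ x + y)
    (hy2 : 2 ≤ y) (hx : 1 - g - m ≤ x) : 0 < G x y := by
  obtain ⟨N, hN⟩ : ∃ N : ℕ, x + y = 1 - g + N := ⟨(x + y - (1 - g)).toNat, by omega⟩
  induction N generalizing x y with
  | zero =>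
    push_cast at hN
    rw [hG.init x y hxy hy (by simpa using hN), stepSource, if_neg (by omega), if_pos (by omega)]
    exact hu
  | succ N ih =>
    push_cast at hN
    rw [hG.step x y hxy hy (by omega)]
    have hv' : x - 1 ≤ -g - 1 ∨ 0 ≤ v := hv.imp (by intro h; omega) id
    have n1 := hG.nonneg hu.le hv' (by omega) hy (by omega)
    have n2 := hG.nonneg (x := x) (y := y - 1) hu.le hv (by omega) (by omega) (by omega)
    by_cases h : 1 - g - m ≤ x - 1
    · have := ih hv' (by omega) hy (by omega) hy2 h (by omega)
      linarith
    · have := ih (x := x) (y := y - 1) hv (by omega) (by omega) (by omega) (by omega) hx (by omega)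
      linarith

/-- Every entry to the right of and above a positive source at `1` is positive, even if there are
no other sources. -/
theorem pos_of_right (hG : BallotGrid g r (stepSource m u v) G) (hu : 0 ≤ u) (hg : 0 ≤ g)
    (hv : 0 < v) {x y : ℤ} (hxy : x < y) (hy : y ≤ r)
    (hy1 : 1 ≤ y) (hx : -g ≤ x) : 0 < G x y := by
  obtain ⟨N, hN⟩ : ∃ N : ℕ, x + y = 1 - g + N := ⟨(x + y - (1 - g)).toNat, by omega⟩
  induction N generalizing x y with
  | zero =>
    push_cast at hN
    rw [hG.init x y hxy hy (by simpa using hN), stepSource, if_pos (by omega)]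
    exact hv
  | succ N ih =>
    push_cast at hN
    rw [hG.step x y hxy hy (by omega)]
    have n1 := hG.nonneg (x := x - 1) (y := y) hu (.inr hv.le) (by omega) hy (by omega)
    have n2 := hG.nonneg (x := x) (y := y - 1) hu (.inr hv.le) (by omega) (by omega) (by omega)
    by_cases h : -g ≤ x - 1
    · have := ih (by omega) hy hy1 h (by omega)
      linarith
    · have := ih (x := x) (y := y - 1) (by omega) (by omega) (by omega) hx (by omega)
      linarith

/-- Along a row, a grid with nonnegative sources is nondecreasing. -/
theorem mono_row (hG : BallotGrid g r (stepSource m u v) G) (hu : 0 ≤ u) (hv : 0 ≤ v)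
    {x x' y : ℤ} (hx : x ≤ x') (hx' : x' < y) (hy : y ≤ r) (hN : 1 - g ≤ x + y) :
    G x y ≤ G x' y := by
  induction x', hx using Int.leInduction with
  | base => exact le_rfl
  | succ z hz ih =>
    rw [hG.step (z + 1) y hx' hy (by omega), add_sub_cancel_right]
    have := hG.nonneg (x := z + 1) (y := y - 1) hu (.inr hv) (by omega) (by omega) (by omega)
    linarith [ih (by omega)]

theorem strictMono_row (hG : BallotGrid g r (stepSource m u v) G) (hu : 0 < u) (hv : 0 ≤ v)
    (hg : 0 ≤ g) (hm : 2 ≤ m)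
    {x x' y : ℤ} (hx : x < x') (hxy : x + 2 < y) (hx' : x' < y) (hy : y ≤ r) (hN : 1 - g ≤ x + y)
    (hy3 : 3 ≤ y) (hxm : - g - m ≤ x) :
    G x y < G x' y := by
  refine lt_of_lt_of_le ?_ (hG.mono_row hu.le hv (x := x + 1) (by omega) hx' hy (by omega))
  rw [hG.step (x + 1) y (by omega) hy (by omega), add_sub_cancel_right]
  have := hG.pos (x := x + 1) (y := y - 1) hu hg hm (.inr hv) (by omega) (by omega) (by omega)
    (by omega) (by omega)
  linarith

/-- Entries in rows of nonpositive number vanish: no path from there reaches a source. -/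
theorem eq_zero_of_nonpos (hG : BallotGrid g r (stepSource m u v) G) {x y : ℤ}
    (hxy : x ≤ y) (hy : y ≤ r) (hy0 : y ≤ 0) (hN : 1 - g ≤ x + y) : G x y = 0 := by
  obtain ⟨N, hN⟩ : ∃ N : ℕ, x + y = 1 - g + N := ⟨(x + y - (1 - g)).toNat, by omega⟩
  induction N generalizing x y with
  | zero =>
    rcases hxy.eq_or_lt with rfl | hlt
    · exact hG.diag _
    · rw [hG.init x y hlt hy (by simpa using hN), stepSource, if_neg (by omega), if_neg (by omega)]
  | succ N ih =>
    push_cast at hN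
    rcases hxy.eq_or_lt with rfl | hlt
    · exact hG.diag _
    · rw [hG.step x y hlt hy (by omega), ih (by omega) hy hy0 (by omega) (by omega),
        ih (by omega) (by omega) (by omega) (by omega) (by omega), add_zero]

theorem row_one (hG : BallotGrid g r (stepSource m u v) G) (hr : 1 ≤ r) {x : ℤ}
    (hx : -g ≤ x) (hx0 : x ≤ 0) : G x 1 = v := by
  induction x, hx using Int.leInduction with
  | base => simp [hG.init (-g) 1 (by omega) hr (by omega), stepSource]
  | succ z hz ih =>
    rw [hG.step (z + 1) 1 (by omega) hr (by omega), add_sub_cancel_right, ih (by omega),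
      hG.eq_zero_of_nonpos (by omega) (by omega) (by omega) (by omega), add_zero]

/-- The propagation principle behind all sign arguments: when the source at `1` is negative,
nonpositivity spreads towards the diagonal. The induction is on the line `x + y = const`: if
`G x y ≤ 0` but `0 ≤ G x (y - 1)`, then `G (x - 1) y ≤ 0`, and the induction hypothesis leads from
`(x - 1, y)` to `(x - 1, y - 1)` and on to `(x, y - 1)`. -/
theorem nonpos_neighbours (hG : BallotGrid g r (stepSource m u v) G) (hu : 0 < u) (hg : 0 ≤ g)
    (hm : 2 ≤ m) (hv : v < 0) {x y : ℤ} (hxy : x < y) (hy : y ≤ r)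
    (hy1 : 1 ≤ y) (hx : -g ≤ x) (h : G x y ≤ 0) :
    (x + 1 < y → 2 ≤ y → G x (y - 1) < 0) ∧ (x + 1 < y → G (x + 1) y ≤ 0) ∧
      (x + 2 < y → G (x + 1) y < 0) := by
  obtain ⟨N, hN⟩ : ∃ N : ℕ, x + y = 1 - g + N := ⟨(x + y - (1 - g)).toNat, by omega⟩
  induction N using Nat.strong_induction_on generalizing x y with
  | _ N ih =>
    have first : x + 1 < y → 2 ≤ y → G x (y - 1) < 0 := by
      intro h1 h2
      have hs := hG.step x y hxy hy (by omega)
      by_cases hx1 : -g ≤ x - 1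
      · by_contra! hc
        have hle : G (x - 1) y ≤ 0 := by linarith
        have i1 := ih (N - 1) (by omega) (x := x - 1) (y := y) (by omega) hy hy1 hx1 hle (by omega)
        -- the entry `(x, y - 1)` lies on the same line, one place nearer to the diagonal
        have i2 := i1.1 (by omega) h2
        have i3 := ih (N - 2) (by omega) (x := x - 1) (y := y - 1) (by omega) (by omega) (by omega)
          hx1 i2.le (by omega)
        by_cases h4 : x + 2 < y
        · have := i3.2.2 (by omega)
          rw [sub_add_cancel] at this
          linarith
        · have hp := hG.pred_eq (y - 1) (by omega) (by omega)
          rw [show y - 1 - 1 = x by omega, show y - 1 - 2 = x - 1 by omega] at hp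
          linarith
      · obtain rfl : x = -g := by omega
        have hn := hG.pos (x := -g - 1) (y := y) hu hg hm (.inl le_rfl) (by omega) hy (by omega) h2
          (by omega)
        linarith
    by_cases hx1 : x + 1 < y
    swap
    · exact ⟨first, fun h => absurd h hx1, fun h => absurd h (by omega)⟩
    have hs := hG.step (x + 1) y hx1 hy (by omega)
    rw [add_sub_cancel_right] at hs
    rcases hy1.eq_or_lt with rfl | hy2
    · have h0 := hG.eq_zero_of_nonpos (x := x + 1) (y := 1 - 1) (by omega) (by omega) (by omega)
        (by omega)
      have h1 := hG.row_one hy hx (by omega)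
      exact ⟨first, fun _ => by linarith, fun _ => by linarith⟩
    have f := first hx1 (by omega)
    have i2 := ih (N - 1) (by omega) (x := x) (y := y - 1) (by omega) (by omega) (by omega)
      hx f.le (by omega)
    by_cases hx2 : x + 2 < y
    · have : G (x + 1) (y - 1) < 0 := by
        by_cases hx3 : x + 3 < y
        · exact i2.2.2 (by omega)
        · have hp := hG.pred_eq (y - 1) (by omega) (by omega)
          rw [show y - 1 - 1 = x + 1 by omega, show y - 1 - 2 = x by omega] at hp
          linarith
      exact ⟨first, fun _ => by linarith, fun _ => by linarith⟩
    · have h0 := hG.diag (x + 1)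
      rw [show y - 1 = x + 1 by omega] at hs
      exact ⟨first, fun _ => by linarith, fun h => absurd h hx2⟩

section NegativeSource

variable (hG : BallotGrid g r (stepSource m u v) G) (hu : 0 < u) (hg : 0 ≤ g) (hm : 2 ≤ m)
  (hv : v < 0)
include hG hu hg hm hv

theorem neg_below {x y : ℤ} (hxy : x + 1 < y) (hy : y ≤ r) (hy1 : 2 ≤ y) (hx : -g ≤ x)
    (h : G x y ≤ 0) : G x (y - 1) < 0 :=
  (hG.nonpos_neighbours hu hg hm hv (by omega) hy (by omega) hx h).1 hxy hy1

theorem nonpos_row {x x' y : ℤ} (hxx : x ≤ x') (hxy : x' < y) (hy : y ≤ r) (hy1 : 1 ≤ y)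
    (hx : -g ≤ x) (h : G x y ≤ 0) : G x' y ≤ 0 := by
  induction x', hxx using Int.leInduction with
  | base => exact h
  | succ z hz ih =>
    exact (hG.nonpos_neighbours hu hg hm hv (by omega) hy hy1 (by omega) (ih (by omega))).2.1 hxy

theorem neg_row {x x' y : ℤ} (hxx : x < x') (hxy : x' < y) (hy : y ≤ r) (hy1 : 1 ≤ y)
    (hxy2 : x + 2 < y) (hx : -g ≤ x) (h : G x y ≤ 0) : G x' y < 0 := by
  have h1 := (hG.nonpos_neighbours hu hg hm hv (by omega) hy hy1 hx h).2.2 hxy2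
  by_cases hc : x' + 1 < y
  · clear hxy
    induction x', (show x + 1 ≤ x' by omega) using Int.leInduction with
    | base => exact h1
    | succ z hz ih =>
      exact (hG.nonpos_neighbours hu hg hm hv (by omega) hy hy1 (by omega)
        (ih (by omega) (by omega)).le).2.2 (by omega)
  · -- the last two entries of a row agree
    obtain rfl : y = x' + 1 := by omega
    have hp := hG.pred_eq (x' + 1) hy (by omega)
    rw [add_sub_cancel_right, show x' + 1 - 2 = x' - 1 by ring] at hp
    rw [hp]
    rcases (show x + 1 ≤ x' - 1 by omega).eq_or_lt with he | hl
    · rwa [← he]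
    clear hp hxx
    have key : ∀ z, x + 1 ≤ z → z + 1 < x' + 1 → G z (x' + 1) < 0 := by
      intro z hz
      induction z, hz using Int.leInduction with
      | base => exact fun _ => h1
      | succ z hz ih =>
        intro hlt
        exact (hG.nonpos_neighbours hu hg hm hv (by omega) hy hy1 (by omega)
          (ih (by omega)).le).2.2 (by omega)
    exact key _ (by omega) (by omega)

theorem neg_antidiag {x y : ℤ} (hxy : x + 2 < y) (hy : y ≤ r) (hy1 : 2 ≤ y) (hx : -g ≤ x)
    (h : G x y ≤ 0) : G (x + 1) (y - 1) < 0 := by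
  have f := hG.neg_below hu hg hm hv (by omega) hy hy1 hx h
  by_cases hx3 : x + 3 < y
  · exact (hG.nonpos_neighbours hu hg hm hv (by omega) (by omega) (by omega) hx f.le).2.2 (by omega)
  · have hp := hG.pred_eq (y - 1) (by omega) (by omega)
    rw [show y - 1 - 1 = x + 1 by omega, show y - 1 - 2 = x by omega] at hp
    linarith

theorem antitone_row {x x' y : ℤ} (hxx : x ≤ x') (hxy : x' < y) (hy : y ≤ r) (hy1 : 2 ≤ y)
    (hx : -g ≤ x) (h : G x (y - 1) ≤ 0) : G x' y ≤ G x y := by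
  induction x', hxx using Int.leInduction with
  | base => exact le_rfl
  | succ z hz ih =>
    rw [hG.step (z + 1) y hxy hy (by omega), add_sub_cancel_right]
    have : G (z + 1) (y - 1) ≤ 0 := by
      rcases (show z + 1 ≤ y - 1 by omega).eq_or_lt with he | hl
      · rw [he, hG.diag]
      · exact hG.nonpos_row hu hg hm hv (by omega) hl (by omega) (by omega) hx h
    linarith [ih (by omega)]

end NegativeSource

end BallotGrid

/-! ### The Jacobi identity in lowest weight -/

/-- The bilinear partner of `stepSource`: the value at `(1 - g - x, x)` of the alternating form
supported on the line `x + y = 1 - g` whose values below the diagonal are given by `stepSource`. -/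
def altSource {A : Type*} [AddGroup A] (g m : ℤ) (u v : A) (x : ℤ) : A :=
  if 1 ≤ x then stepSource m u v x else -stepSource m u v (1 - g - x)

section altSource

variable {A : Type*} [AddGroup A] {g m : ℤ} {u v : A} {x : ℤ}

theorem altSource_mid (h2 : 2 ≤ x) (hm : x ≤ m) : altSource g m u v x = u := by
  rw [altSource, if_pos (by omega), stepSource, if_neg (by omega), if_pos ⟨h2, hm⟩]

theorem altSource_one : altSource g m u v 1 = v := by
  simp [altSource, stepSource]

theorem altSource_high (hm : 2 ≤ m) (h : m < x) : altSource g m u v x = 0 := by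
  rw [altSource, if_pos (by omega), stepSource, if_neg (by omega), if_neg (by omega)]

theorem altSource_gap (h : -g < x) (h' : x ≤ 0) : altSource g m u v x = 0 := by
  rw [altSource, if_neg (by omega), stepSource, if_neg (by omega), if_neg (by omega), neg_zero]

theorem altSource_neg (hg : 0 ≤ g) : altSource g m u v (-g) = -v := by
  rw [altSource, if_neg (by omega), stepSource, if_pos (by omega)]

theorem altSource_left (hg : 0 ≤ g) (h : 1 - g - m ≤ x) (h' : x ≤ -g - 1) :
    altSource g m u v x = -u := by
  rw [altSource, if_neg (by omega), stepSource, if_neg (by omega), if_pos (by omega)]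

end altSource

/-- A ballot grid with sources `1` at `2, …, m` and `v` at `1` that satisfies the Jacobi identity
in lowest weight: `c` holds the leading structure constants, and the triples of indices
summing to `S` are those whose iterated bracket is a multiple of the central vector. -/
structure JacobiGrid {K : Type*} [Field K] (g m r S : ℤ) (v : K) (c : ℤ → ℤ → K) : Prop extends
    BallotGrid g r (stepSource m 1 v) c where
  jacobi : ∀ x y z, x < y → y < z → z ≤ r → 1 - g ≤ x + y → x + y + z = S →
    c x y * altSource g m 1 v z + c y z * altSource g m 1 v x - c x z * altSource g m 1 v y = 0

namespace JacobiGrid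

variable {K : Type*} [Field K] {g m r S : ℤ} {v : K} {c : ℤ → ℤ → K}

theorem restrict (h : JacobiGrid g m r S v c) {r' : ℤ} (hr : r' ≤ r) :
    JacobiGrid g m r' S v c where
  diag := h.diag
  step x y h1 h2 h3 := h.step x y h1 (h2.trans hr) h3
  init x y h1 h2 h3 := h.init x y h1 (h2.trans hr) h3
  jacobi x y z h1 h2 h3 := h.jacobi x y z h1 h2 (h3.trans hr)

/-- If the source at `1` is real, the imaginary parts form a grid without sources, so that the
whole grid is real. -/
theorem re {c : ℤ → ℤ → ℂ} {t : ℝ} (h : JacobiGrid g m r S (t : ℂ) c) :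
    JacobiGrid g m r S t (fun x y => (c x y).re) := by
  have hre := h.toBallotGrid.map Complex.reAddGroupHom
  have him := h.toBallotGrid.map Complex.imAddGroupHom
  simp only [Complex.coe_reAddGroupHom, Complex.coe_imAddGroupHom, Complex.one_re, Complex.one_im,
    Complex.ofReal_re, Complex.ofReal_im] at hre him
  have hneg := him.map (-AddMonoidHom.id ℝ)
  simp only [AddMonoidHom.neg_apply, AddMonoidHom.id_apply, neg_zero] at hneg
  have hc : ∀ x y, x ≤ y → y ≤ r → 1 - g ≤ x + y → c x y = ((c x y).re : ℂ) := by
    intro x y h1 h2 h3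
    have a1 := him.nonneg le_rfl (.inr le_rfl) h1 h2 h3
    have a2 := hneg.nonneg le_rfl (.inr le_rfl) h1 h2 h3
    apply Complex.ext
    · simp
    · simp; linarith
  have hs : ∀ x, altSource g m 1 (t : ℂ) x = ((altSource g m 1 t x : ℝ) : ℂ) := by
    intro x
    simp only [altSource, stepSource]
    split_ifs <;> simp
  refine { toBallotGrid := hre, jacobi := ?_ }
  intro x y z h1 h2 h3 h4 h5
  have := h.jacobi x y z h1 h2 h3 h4 h5
  rw [hs, hs, hs, hc x y (by omega) (by omega) (by omega), hc y z (by omega) (by omega) (by omega),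
    hc x z (by omega) (by omega) (by omega)] at this
  exact_mod_cast this

/-! ### Sources up to the top row -/

section Full

variable (h : JacobiGrid g m m S v c) {x : ℤ} (hS : S = x + 2 * m - 1) (hx : x + 4 ≤ m)
  (hxl : 4 - m - g ≤ x) (hm : 4 ≤ m)
include h hS hx hxl hm

/-- The Jacobi identity for the triple `(x, m - 1, m)`. -/
theorem full_first : c (x - 1) m = c (m - 1) m * altSource g m 1 v x := by
  have j := h.jacobi x (m - 1) m (by omega) (by omega) le_rfl (by omega) (by omega)
  rw [altSource_mid (by omega) le_rfl, altSource_mid (x := m - 1) (by omega) (by omega),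
    h.step x m (by omega) le_rfl (by omega)] at j
  linear_combination -j

/-- The Jacobi identity for the triple `(x + 1, m - 2, m)`. -/
theorem full_second :
    c x m + c x (m - 1) = c (m - 1) m * altSource g m 1 v (x + 1) := by
  have j := h.jacobi (x + 1) (m - 2) m (by omega) (by omega) le_rfl (by omega) (by omega)
  have s1 := h.step (x + 1) m (by omega) le_rfl (by omega)
  have s2 := h.step (x + 1) (m - 1) (by omega) (by omega) (by omega)
  rw [altSource_mid (by omega) le_rfl, altSource_mid (x := m - 2) (by omega) (by omega),
    ← h.pred_eq m le_rfl (by omega)] at j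
  rw [add_sub_cancel_right] at s1 s2
  rw [show m - 1 - 1 = m - 2 by ring] at s2
  linear_combination -j - s1 - s2

end Full

/-- All entries that occur are positive under `f`. This contradicts `full_first` and `full_second`;
only for `x = 1` the monotonicity of the two top rows is needed as well. -/
theorem full_false_of_nonneg (h : JacobiGrid g m m S v c) (f : K →+ ℝ) (f1 : f 1 = 1)
    (fv : 0 ≤ f v) {x : ℤ} (hg : 0 ≤ g) (hS : S = x + 2 * m - 1) (hx : x + 4 + g ≤ m)
    (hxl : 4 - m - g ≤ x) (hm : 4 ≤ m) : False := by
  have e1 := h.full_first hS (by omega) hxl hm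
  have e2 := h.full_second hS (by omega) hxl hm
  have hG := h.toBallotGrid.map f
  rw [f1] at hG
  have P : ∀ x y, x < y → y ≤ m → 1 - g ≤ x + y → 2 ≤ y → 1 - g - m ≤ x → 0 < f (c x y) :=
    fun x y h1 h2 h3 h4 h5 => hG.pos one_pos hg (by omega) (.inr fv) h1 h2 h3 h4 h5
  have pK := P (m - 1) m (by omega) le_rfl (by omega) (by omega) (by omega)
  have pA := P (x - 1) m (by omega) le_rfl (by omega) (by omega) (by omega)
  have pB := P x (m - 1) (by omega) (by omega) (by omega) (by omega) (by omega)
  have pC := P x m (by omega) (by omega) (by omega) (by omega) (by omega)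
  rcases lt_or_ge x (-g) with hlt | hge
  · rw [altSource_left hg (by omega) (by omega)] at e1
    have := congrArg f e1
    simp at this; linarith
  rcases hge.eq_or_lt with rfl | hgt
  · rw [altSource_neg hg] at e1
    rcases hg.eq_or_lt with rfl | hg1
    · rw [neg_zero, zero_add, altSource_one] at e2
      have : c (-0 - 1) m + c (-0) m + c (-0) (m - 1) = 0 := by
        rw [neg_zero] at *
        linear_combination e1 + e2
      have := congrArg f this
      simp at this pA pB pC; linarith
    · rw [altSource_gap (by omega) (by omega), mul_zero] at e2
      have := congrArg f e2
      simp at this; linarith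
  rcases le_or_gt x 0 with h0 | h0
  · rw [altSource_gap hgt h0, mul_zero] at e1
    have := congrArg f e1
    simp at this; linarith
  rcases (show 1 ≤ x by omega).eq_or_lt with rfl | h2
  · rw [altSource_mid (by omega) (by omega), mul_one, h.pred_eq m le_rfl (by omega)] at e2
    have s := hG.step (m - 2) m (by omega) le_rfl (by omega)
    have p := hG.pred_eq (m - 1) (by omega) (by omega)
    have m1 := hG.mono_row zero_le_one fv (x := 1) (x' := m - 2 - 1) (y := m) (by omega) (by omega)
      le_rfl (by omega)
    have m2 := hG.strictMono_row one_pos fv hg (by omega) (x := 1) (x' := m - 1 - 2) (y := m - 1)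
      (by omega) (by omega) (by omega) (by omega) (by omega) (by omega) (by omega)
    rw [show m - 1 - 1 = m - 2 by ring] at p
    have := congrArg f e2
    simp only [map_add] at this
    linarith
  · rw [altSource_mid (by omega) (by omega), mul_one] at e1 e2
    have s := hG.step x m (by omega) le_rfl (by omega)
    have e1 := congrArg f e1
    have e2 := congrArg f e2
    simp only [map_add] at e1 e2 s
    linarith

/-- For `x ≥ -g` the identities `full_first` and `full_second` produce a nonpositive entry, and its
propagation towards the diagonal is incompatible with them. -/
theorem full_false_of_neg {v : ℝ} {c : ℤ → ℤ → ℝ} (h : JacobiGrid g m m S v c)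
    (hv : v < 0) {x : ℤ} (hg : 0 ≤ g) (hS : S = x + 2 * m - 1) (hx : x + 4 + g ≤ m)
    (hxl : 4 - m - g ≤ x) (hm : 4 ≤ m) : False := by
  have e1 := h.full_first hS (by omega) hxl hm
  have e2 := h.full_second hS (by omega) hxl hm
  have hG := h.toBallotGrid
  have s := hG.step x m (by omega) le_rfl (by omega)
  have m2 : 2 ≤ m := by omega
  have L : ∀ x y, x < y → y ≤ m → 1 - g ≤ x + y → 2 ≤ y → 1 - g - m ≤ x → x ≤ -g - 1 → 0 < c x y :=
    fun x y h1 h2 h3 h4 h5 h6 => hG.pos one_pos hg (by omega) (.inl h6) h1 h2 h3 h4 h5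
  rcases lt_or_ge x (-g) with hlt | hge
  · have pA := L (x - 1) m (by omega) le_rfl (by omega) (by omega) (by omega) (by omega)
    have pB := L x (m - 1) (by omega) (by omega) (by omega) (by omega) (by omega) (by omega)
    rw [altSource_left hg (by omega) (by omega)] at e1
    rcases (show x + 1 ≤ -g by omega).eq_or_lt with he | hl
    · rw [he, altSource_neg hg] at e2
      nlinarith
    · rw [altSource_left hg (by omega) (by omega)] at e2
      linarith
  rcases hge.eq_or_lt with rfl | hgt
  · have pA := L (-g - 1) m (by omega) le_rfl (by omega) (by omega) (by omega) (by omega)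
    rw [altSource_neg hg] at e1
    have hK : 0 < c (m - 1) m := by nlinarith
    refine hK.not_ge ?_
    rcases hg.eq_or_lt with rfl | hg1
    · rw [neg_zero] at *
      rw [zero_add, altSource_one] at e2
      exact hG.nonpos_row one_pos hg m2 hv (x := 0) (by omega) (by omega) le_rfl (by omega)
        (by omega) (by linarith)
    · rw [altSource_gap (by omega) (by omega), mul_zero] at e2
      have b0 : c (-g) (m - 1) < 0 := by linarith
      have b1 := hG.neg_below one_pos hg m2 hv (x := -g) (y := m - 1) (by omega) (by omega)
        (by omega) le_rfl b0.le
      have b2 := hG.nonpos_row one_pos hg m2 hv (x := -g) (x' := -g + 1) (y := m - 1 - 1) (by omega)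
        (by omega) (by omega) (by omega) le_rfl b1.le
      have s1 := hG.step (-g + 1) m (by omega) le_rfl (by omega)
      have s2 := hG.step (-g + 1) (m - 1) (by omega) (by omega) (by omega)
      rw [add_sub_cancel_right] at s1 s2
      exact hG.nonpos_row one_pos hg m2 hv (x := -g + 1) (by omega) (by omega) le_rfl (by omega)
        (by omega) (by linarith)
  rcases le_or_gt x 0 with h0 | h0
  · rw [altSource_gap hgt h0, mul_zero] at e1
    rcases h0.eq_or_lt with rfl | h0
    · have b := hG.neg_below one_pos hg m2 hv (x := 0 - 1) (y := m) (by omega) le_rfl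
        (by omega) (by omega) e1.le
      have b' := hG.neg_antidiag one_pos hg m2 hv (x := 0 - 1) (y := m) (by omega) le_rfl
        (by omega) (by omega) e1.le
      have hK := hG.nonpos_row one_pos hg m2 hv (x := 0 - 1) (x' := m - 1) (y := m) (by omega)
        (by omega) le_rfl (by omega) (by omega) e1.le
      rw [zero_add, altSource_one] at e2
      rw [sub_add_cancel] at b'
      nlinarith
    · have b' := hG.neg_antidiag one_pos hg m2 hv (x := x - 1) (y := m) (by omega) le_rfl
        (by omega) (by omega) e1.le
      rw [altSource_gap (by omega) (by omega), mul_zero] at e2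
      rw [sub_add_cancel] at b'
      linarith
  rcases (show 1 ≤ x by omega).eq_or_lt with rfl | h2
  · rw [altSource_one] at e1
    rw [altSource_mid (by omega) (by omega), mul_one] at e2
    have pA : 0 < c (1 - 1) m := by
      by_contra! hc
      have hK := hG.neg_row one_pos hg m2 hv (x := 1 - 1) (x' := m - 1) (y := m) (by omega)
        (by omega) le_rfl (by omega) (by omega) (by omega) hc
      nlinarith
    have hK : c (m - 1) m < 0 := by
      by_contra! hc
      nlinarith
    have hB : c 1 (m - 1) < 0 := by linarith
    have b1 := hG.neg_antidiag one_pos hg m2 hv (x := 1) (y := m - 1) (by omega) (by omega)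
      (by omega) (by omega) hB.le
    have b3 := hG.nonpos_row one_pos hg m2 hv (x := 1) (x' := 2) (y := m - 1) (by omega)
      (by omega) (by omega) (by omega) (by omega) hB.le
    have b4 := hG.antitone_row one_pos hg m2 hv (x := 2) (x' := m - 1) (y := m) (by omega)
      (by omega) le_rfl (by omega) (by omega) b3
    have s1 := hG.step 2 m (by omega) le_rfl (by omega)
    have s2 := hG.step 2 (m - 1) (by omega) (by omega) (by omega)
    norm_num at s1 s2 b1
    linarith
  · rw [altSource_mid (by omega) (by omega), mul_one] at e1 e2
    have hB : c x (m - 1) = 0 := by linarith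
    have b1 := hG.neg_row one_pos hg m2 hv (x := x) (x' := x + 1) (y := m - 1) (by omega)
      (by omega) (by omega) (by omega) (by omega) (by omega) hB.le
    have b4 := hG.antitone_row one_pos hg m2 hv (x := x + 1) (x' := m - 1) (y := m) (by omega)
      (by omega) le_rfl (by omega) (by omega) b1.le
    have s1 := hG.step (x + 1) m (by omega) le_rfl (by omega)
    rw [add_sub_cancel_right] at s1
    linarith

/-! ### Sources up to the row below the top row -/

section Penultimate

variable (h : JacobiGrid g m (m + 1) S v c) {x : ℤ} (hS : S = x + 2 * m + 1) (hx : x + 4 ≤ m)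
  (hxl : 2 - m - g ≤ x) (hm : 3 ≤ m)
include h hS hx hxl hm

/-- The Jacobi identity for the triple `(x, m, m + 1)`. -/
theorem penultimate_first : c x (m + 1) = c m (m + 1) * altSource g m 1 v x := by
  have j := h.jacobi x m (m + 1) (by omega) (by omega) le_rfl (by omega) (by omega)
  rw [altSource_mid (x := m) (by omega) le_rfl, altSource_high (by omega) (by omega)] at j
  linear_combination -j

/-- The Jacobi identity for the triple `(x + 1, m - 1, m + 1)`. -/
theorem penultimate_second :
    c (x + 1) (m + 1) = c m (m + 1) * altSource g m 1 v (x + 1) := by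
  have j := h.jacobi (x + 1) (m - 1) (m + 1) (by omega) (by omega) le_rfl (by omega) (by omega)
  have p := h.pred_eq (m + 1) le_rfl (by omega)
  rw [show m + 1 - 1 = m by ring, show m + 1 - 2 = m - 1 by ring] at p
  rw [altSource_mid (x := m - 1) (by omega) (by omega), altSource_high (by omega) (by omega),
    ← p] at j
  linear_combination -j

end Penultimate

theorem penultimate_false_of_nonneg (h : JacobiGrid g m (m + 1) S v c) (f : K →+ ℝ) (f1 : f 1 = 1)
    (fv : 0 ≤ f v) {x : ℤ} (hg : 0 ≤ g) (hS : S = x + 2 * m + 1) (hx : x + 4 + g ≤ m)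
    (hxl : 2 - m - g ≤ x) (hm : 3 ≤ m) : False := by
  have e1 := h.penultimate_first hS (by omega) hxl hm
  have e2 := h.penultimate_second hS (by omega) hxl hm
  have hG := h.toBallotGrid.map f
  rw [f1] at hG
  have P : ∀ x y, x < y → y ≤ m + 1 → 1 - g ≤ x + y → 2 ≤ y → 1 - g - m ≤ x → 0 < f (c x y) :=
    fun x y h1 h2 h3 h4 h5 => hG.pos one_pos hg (by omega) (.inr fv) h1 h2 h3 h4 h5
  have pK := P m (m + 1) (by omega) le_rfl (by omega) (by omega) (by omega)
  have pA := P x (m + 1) (by omega) le_rfl (by omega) (by omega) (by omega)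
  have pB := P (x + 1) (m + 1) (by omega) le_rfl (by omega) (by omega) (by omega)
  have p := hG.pred_eq (m + 1) le_rfl (by omega)
  rw [show m + 1 - 1 = m by ring, show m + 1 - 2 = m - 1 by ring] at p
  rcases lt_or_ge x (-g) with hlt | hge
  · rw [altSource_left hg (by omega) (by omega)] at e1
    have := congrArg f e1
    simp at this; linarith
  rcases hge.eq_or_lt with rfl | hgt
  · rcases hg.eq_or_lt with rfl | hg1
    · rw [altSource_neg le_rfl] at e1
      rw [neg_zero, zero_add] at *
      rw [altSource_one] at e2
      have : c 0 (m + 1) + c 1 (m + 1) = 0 := by linear_combination e1 + e2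
      have := congrArg f this
      simp at this; linarith
    · rw [altSource_gap (by omega) (by omega), mul_zero] at e2
      rw [e2, map_zero] at pB
      exact lt_irrefl _ pB
  rcases le_or_gt x 0 with h0 | h0
  · rw [altSource_gap hgt h0, mul_zero] at e1
    rw [e1, map_zero] at pA
    exact lt_irrefl _ pA
  rw [altSource_mid (by omega) (by omega), mul_one] at e2
  have m2 := hG.strictMono_row one_pos fv hg (by omega) (x := x + 1) (x' := m - 1) (y := m + 1)
    (by omega) (by omega) (by omega) (by omega) (by omega) (by omega) (by omega)
  rw [e2] at m2
  linarith

theorem penultimate_false_of_neg {v : ℝ} {c : ℤ → ℤ → ℝ} (h : JacobiGrid g m (m + 1) S v c)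
    (hv : v < 0) {x : ℤ} (hg : 0 ≤ g) (hS : S = x + 2 * m + 1) (hx : x + 4 + g ≤ m)
    (hxl : 2 - m - g ≤ x) (hm : 3 ≤ m) : False := by
  have e1 := h.penultimate_first hS (by omega) hxl hm
  have e2 := h.penultimate_second hS (by omega) hxl hm
  have hG := h.toBallotGrid
  have s := hG.step (x + 1) (m + 1) (by omega) le_rfl (by omega)
  have m2 : 2 ≤ m := by omega
  have L : ∀ x y, x < y → y ≤ m + 1 → 1 - g ≤ x + y → 2 ≤ y → 1 - g - m ≤ x → x ≤ -g - 1 →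
      0 < c x y :=
    fun x y h1 h2 h3 h4 h5 h6 => hG.pos one_pos hg (by omega) (.inl h6) h1 h2 h3 h4 h5
  rw [add_sub_cancel_right, add_sub_cancel_right] at s
  rcases lt_or_ge x (-g) with hlt | hge
  · rw [altSource_left hg (by omega) (by omega)] at e1
    rcases (show x + 1 ≤ -g by omega).eq_or_lt with he | hl
    · obtain rfl : x = -g - 1 := by omega
      rw [sub_add_cancel] at *
      rw [altSource_neg hg] at e2
      -- `c (-g - 1) (m + 1) ≥ 1` and `c (-g) m ≥ v`, by following the two columns down
      have c1 : ∀ y, 2 ≤ y → y ≤ m + 1 → 1 ≤ c (-g - 1) y := by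
        intro y hy
        induction y, hy using Int.leInduction with
        | base =>
          intro _
          rw [hG.init (-g - 1) 2 (by omega) (by omega) (by omega), stepSource, if_neg (by omega),
            if_pos (by omega)]
        | succ y hy ih =>
          intro hy'
          rw [hG.step (-g - 1) (y + 1) (by omega) hy' (by omega), add_sub_cancel_right]
          have := hG.nonneg zero_le_one (x := -g - 1 - 1) (y := y + 1) (.inl (by omega)) (by omega)
            (by omega) (by omega)
          linarith [ih (by omega)]
      have c2 : ∀ y, 1 ≤ y → y ≤ m → v ≤ c (-g) y := by
        intro y hy
        induction y, hy using Int.leInduction with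
        | base => exact fun _ => (hG.row_one (by omega) le_rfl (by omega)).ge
        | succ y hy ih =>
          intro hy'
          rw [hG.step (-g) (y + 1) (by omega) (by omega) (by omega), add_sub_cancel_right]
          linarith [ih (by omega), c1 (y + 1) (by omega) (by omega)]
      nlinarith [c1 (m + 1) (by omega) le_rfl, c2 m (by omega) le_rfl]
    · rw [altSource_left hg (by omega) (by omega)] at e2
      have := L (x + 1) m (by omega) (by omega) (by omega) (by omega) (by omega) (by omega)
      linarith
  -- a nonpositive entry in the top row makes the last entry of that row negative
  have hneg : ∀ x, -g ≤ x → x + 1 < m → c x (m + 1) ≤ 0 → c m (m + 1) < 0 := fun x hx h1 h =>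
    hG.neg_row one_pos hg m2 hv (x := x) (by omega) (by omega) le_rfl (by omega) (by omega) hx h
  have hneg' : ∀ x, -g ≤ x → x + 1 < m → c x (m + 1) ≤ 0 → c (x + 1) (m + 1) < 0 := fun x hx h1 h =>
    hG.neg_row one_pos hg m2 hv (x := x) (by omega) (by omega) le_rfl (by omega) (by omega) hx h
  rcases hge.eq_or_lt with rfl | hgt
  · rw [altSource_neg hg] at e1
    rcases hg.eq_or_lt with rfl | hg1
    · rw [neg_zero] at *
      rw [zero_add, altSource_one] at e2
      rcases le_or_gt (c 0 (m + 1)) 0 with hc | hc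
      · have := hneg' 0 le_rfl (by omega) hc
        rw [zero_add] at this
        linarith
      · have := hneg 1 (by omega) (by omega) (by linarith)
        nlinarith
    · rw [altSource_gap (by omega) (by omega), mul_zero] at e2
      have hK := hneg (-g + 1) (by omega) (by omega) e2.le
      have := hneg' (-g) le_rfl (by omega) (by nlinarith)
      linarith
  rcases le_or_gt x 0 with h0 | h0
  · rw [altSource_gap hgt h0, mul_zero] at e1
    have b := hneg' x hge (by omega) e1.le
    rcases h0.eq_or_lt with rfl | h0
    · rw [zero_add, altSource_one] at e2
      have hK := hneg 0 hge (by omega) e1.le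
      rw [zero_add] at b
      nlinarith
    · rw [altSource_gap (by omega) (by omega), mul_zero] at e2
      linarith
  rw [altSource_mid (by omega) (by omega), mul_one] at e2
  have s1 := hG.step (x + 2) (m + 1) (by omega) le_rfl (by omega)
  rw [add_sub_cancel_right, show x + 2 - 1 = x + 1 by ring] at s1
  -- once the row below has become nonpositive, the top row decreases strictly
  have key : c (x + 1) m ≤ 0 → False := by
    intro hc
    have b1 := hG.neg_row one_pos hg m2 hv (x := x + 1) (x' := x + 2) (y := m) (by omega)
      (by omega) (by omega) (by omega) (by omega) (by omega) hc
    have b2 := hG.antitone_row one_pos hg m2 hv (x := x + 2) (x' := m) (y := m + 1) (by omega)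
      (by omega) le_rfl (by omega) (by omega) (by rw [add_sub_cancel_right]; exact b1.le)
    linarith
  rcases (show 1 ≤ x by omega).eq_or_lt with rfl | h2
  · rw [altSource_one] at e1
    have hA : 0 < c 1 (m + 1) := by
      by_contra! hc
      have := hneg 1 (by omega) (by omega) hc
      nlinarith
    have hK : c m (m + 1) < 0 := by
      by_contra! hc
      nlinarith
    exact key (by linarith)
  · rw [altSource_mid (by omega) (by omega), mul_one] at e1
    exact key (by linarith)

/-! ### Sources staying below the two top rows -/

/-- The Jacobi identity for a triple with two indices above `m`. -/
theorem mul_altSource_eq_zero (h : JacobiGrid g m r S v c) (hm : 2 ≤ m) {x y z : ℤ} (hxy : x < y)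
    (hy : m < y) (hyz : y < z) (hz : z ≤ r) (hN : 1 - g ≤ x + y) (hS : x + y + z = S) :
    c y z * altSource g m 1 v x = 0 := by
  have j := h.jacobi x y z hxy hyz hz hN hS
  rwa [altSource_high hm hy, altSource_high hm (by omega), mul_zero, mul_zero, zero_add,
    sub_zero] at j

/-- The Jacobi identity for a triple with `m` in the middle. -/
theorem eq_mul_altSource (h : JacobiGrid g m r S v c) (hm : 2 ≤ m) {x z : ℤ} (hxm : x < m)
    (hmz : m < z) (hz : z ≤ r) (hN : 1 - g ≤ x + m) (hS : x + m + z = S) :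
    c x z = c m z * altSource g m 1 v x := by
  have j := h.jacobi x m z hxm hmz hz hN hS
  rw [altSource_mid hm le_rfl, altSource_high hm hmz] at j
  linear_combination -j

/-- All entries that occur are nonzero, whereas `mul_altSource_eq_zero` makes one of them vanish
where the source does not, and `eq_mul_altSource` where the source does. In the remaining
cases strict monotonicity of a row contradicts `eq_mul_altSource`. -/
theorem tall_false_of_nonneg (h : JacobiGrid g m r S v c) (f : K →+ ℝ) (f1 : f 1 = 1)
    (fv : 0 ≤ f v) {x : ℤ} (hg : 0 ≤ g) (hm : 2 ≤ m) (hr : m + 2 ≤ r)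
    (hS : S = x + 2 * m + 3) (hx : x + m + 8 + g ≤ 2 * r) (hxl : 1 - m - g ≤ x) : False := by
  have hG := h.toBallotGrid.map f
  rw [f1] at hG
  have P : ∀ x y, x < y → y ≤ r → 1 - g ≤ x + y → 2 ≤ y → 1 - g - m ≤ x → c x y ≠ 0 := by
    intro x y h1 h2 h3 h4 h5 h0
    have := hG.pos one_pos hg (by omega) (.inr fv) h1 h2 h3 h4 h5
    simp [h0] at this
  have T2 : x + 1 < m → _ := fun hx => h.eq_mul_altSource hm (x := x + 1) (z := m + 2) hx (by omega)
    (by omega) (by omega) (by omega)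
  rcases lt_or_ge x (-g) with hlt | hge
  · have T1 := h.mul_altSource_eq_zero hm (x := x) (y := m + 1) (z := m + 2) (by omega) (by omega)
      (by omega) (by omega) (by omega) (by omega)
    rw [altSource_left hg (by omega) (by omega), mul_neg, mul_one, neg_eq_zero] at T1
    exact P _ _ (by omega) (by omega) (by omega) (by omega) (by omega) T1
  rcases le_or_gt x (-1) with h0 | h0
  · have T2 := T2 (by omega)
    rw [altSource_gap (by omega) (by omega), mul_zero] at T2
    exact P _ _ (by omega) (by omega) (by omega) (by omega) (by omega) T2
  rcases (show 0 ≤ x by omega).eq_or_lt with rfl | h1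
  · rcases hg.eq_or_lt with rfl | hg1
    · have T1 := h.mul_altSource_eq_zero hm (x := -0) (y := m + 1) (z := m + 2) (by omega)
        (by omega) (by omega) (by omega) (by omega) (by omega)
      rw [altSource_neg le_rfl] at T1
      have T2 := T2 (by omega)
      rw [zero_add, altSource_one] at T2
      have hv : v = 0 := neg_eq_zero.mp ((mul_eq_zero.mp T1).resolve_left
        (P _ _ (by omega) (by omega) (by omega) (by omega) (by omega)))
      rw [hv, mul_zero] at T2
      exact P _ _ (by omega) (by omega) (by omega) (by omega) (by omega) T2
    · rcases le_or_gt m 3 with h3 | h3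
      · have T := h.eq_mul_altSource hm (x := 0) (z := m + 3) (by omega) (by omega)
          (by omega) (by omega) (by omega)
        rw [altSource_gap (by omega) (by omega), mul_zero] at T
        exact P _ _ (by omega) (by omega) (by omega) (by omega) (by omega) T
      · have T := h.eq_mul_altSource hm (x := 2) (z := m + 1) (by omega) (by omega)
          (by omega) (by omega) (by omega)
        rw [altSource_mid le_rfl (by omega), mul_one] at T
        have p := hG.pred_eq (m + 1) (by omega) (by omega)
        rw [show m + 1 - 1 = m by ring, show m + 1 - 2 = m - 1 by ring] at p
        have m2 := hG.strictMono_row one_pos fv hg (by omega) (x := 2) (x' := m - 1) (y := m + 1)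
          (by omega) (by omega) (by omega) (by omega) (by omega) (by omega) (by omega)
        rw [T] at m2
        exact m2.ne' p.symm
  rcases lt_or_ge x m with hxm | hxm
  · rcases (show 1 ≤ x by omega).eq_or_lt with h1 | h2
    · obtain rfl : x = 1 := by omega
      rcases hm.eq_or_lt with rfl | hm3
      · rcases hg.eq_or_lt with rfl | hg1
        · have T1 := h.mul_altSource_eq_zero hm (x := -0) (y := 3) (z := 5) (by omega) (by omega)
            (by omega) (by omega) (by omega) (by omega)
          rw [altSource_neg le_rfl] at T1
          have hv : v = 0 := neg_eq_zero.mp ((mul_eq_zero.mp T1).resolve_left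
            (P _ _ (by omega) (by omega) (by omega) (by omega) (by omega)))
          have T := h.eq_mul_altSource hm (x := 1) (z := 5) (by omega) (by omega)
            (by omega) (by omega) (by omega)
          rw [altSource_one, hv, mul_zero] at T
          exact P _ _ (by omega) (by omega) (by omega) (by omega) (by omega) T
        · have T := h.eq_mul_altSource hm (x := 0) (z := 6) (by omega) (by omega)
            (by omega) (by omega) (by omega)
          rw [altSource_gap (by omega) (by omega), mul_zero] at T
          exact P _ _ (by omega) (by omega) (by omega) (by omega) (by omega) T
      · have T2 := T2 (by omega)
        rw [altSource_mid (by omega) (by omega), mul_one] at T2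
        have m2 := hG.strictMono_row one_pos fv hg (by omega) (x := 1 + 1) (x' := m) (y := m + 2)
          (by omega) (by omega) (by omega) (by omega) (by omega) (by omega) (by omega)
        rw [T2] at m2
        exact lt_irrefl _ m2
    · have T1 := h.mul_altSource_eq_zero hm (x := x) (y := m + 1) (z := m + 2) (by omega) (by omega)
        (by omega) (by omega) (by omega) (by omega)
      rw [altSource_mid (by omega) (by omega), mul_one] at T1
      exact P _ _ (by omega) (by omega) (by omega) (by omega) (by omega) T1
  · have T := h.mul_altSource_eq_zero hm (x := m) (y := (x + m + 4) / 2 - 1)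
      (z := x + m + 3 - ((x + m + 4) / 2 - 1)) (by omega) (by omega)
      (by omega) (by omega) (by omega) (by omega)
    rw [altSource_mid (by omega) (by omega), mul_one] at T
    exact P _ _ (by omega) (by omega) (by omega) (by omega) (by omega) T

section Neg

variable {v : ℝ} {c : ℤ → ℤ → ℝ}

/-- The triples `(0, m, z + 1)` and `(1, m, z)` give `c 0 (z + 1) = 0` and `c 1 z = v * c m z`.
By propagation from the former, `c 1 z < 0` and `c m z ≤ 0`, which contradicts the latter. -/
theorem false_of_zero_one (h : JacobiGrid g m r S v c) (hv : v < 0) (hg : 1 ≤ g) (hm : 2 ≤ m)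
    {z : ℤ} (hmz : m < z) (hz : z + 1 ≤ r) (hS : m + z + 1 = S) : False := by
  have e0 := h.eq_mul_altSource hm (x := 0) (z := z + 1) (by omega) (by omega) hz (by omega)
    (by omega)
  have e1 := h.eq_mul_altSource hm (x := 1) (z := z) (by omega) (by omega) (by omega) (by omega)
    (by omega)
  rw [altSource_gap (by omega) le_rfl, mul_zero] at e0
  rw [altSource_one] at e1
  have hG := h.toBallotGrid
  have a1 := hG.neg_below one_pos (by omega) hm hv (x := 0) (y := z + 1) (by omega) hz (by omega)
    (by omega) e0.le
  have a2 := hG.neg_antidiag one_pos (by omega) hm hv (x := 0) (y := z + 1) (by omega) hz (by omega)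
    (by omega) e0.le
  rw [add_sub_cancel_right] at a1 a2
  rw [zero_add] at a2
  have a3 := hG.nonpos_row one_pos (by omega) hm hv (x := 0) (x' := m) (y := z) (by omega) hmz
    (by omega) (by omega) (by omega) a1.le
  nlinarith

/-- If the source does not vanish at `x`, the triple `(x, m + 1, m + 2)` makes the last entry
of the row `m + 2` vanish, and the triple `(x + 1, m, m + 2)` then puts a zero further left
in this row. -/
theorem false_of_altSource_ne_zero (h : JacobiGrid g m r S v c) (hv : v < 0) {x : ℤ} (hg : 0 ≤ g)
    (hm : 2 ≤ m) (hr : m + 2 ≤ r) (hS : S = x + 2 * m + 3) (hx : x + 2 ≤ m)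
    (hxl : 1 - m - g ≤ x) (hne : altSource g m 1 v x ≠ 0) : False := by
  have hG := h.toBallotGrid
  have T1 := h.mul_altSource_eq_zero hm (x := x) (y := m + 1) (z := m + 2) (by omega) (by omega)
    (by omega) (by omega) (by omega) (by omega)
  have T2 := h.eq_mul_altSource hm (x := x + 1) (z := m + 2) (by omega) (by omega)
    (by omega) (by omega) (by omega)
  have p := hG.pred_eq (m + 2) (by omega) (by omega)
  rw [show m + 2 - 1 = m + 1 by ring, show m + 2 - 2 = m by ring] at p
  have hK : c m (m + 2) = 0 := by rw [← p]; exact (mul_eq_zero.mp T1).resolve_right hne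
  rw [hK, zero_mul] at T2
  rcases le_or_gt (x + 1) (-g - 1) with hl | hl
  · exact (hG.pos one_pos hg hm (.inl hl) (by omega) (by omega) (by omega) (by omega)
      (by omega)).ne' T2
  · exact (hG.neg_row one_pos hg hm hv (x := x + 1) (x' := m) (y := m + 2) (by omega) (by omega) hr
      (by omega) (by omega) (by omega) T2.le).ne hK

theorem tall_false_of_neg (h : JacobiGrid g m r S v c) (hv : v < 0) {x : ℤ} (hg : 0 ≤ g)
    (hm : 2 ≤ m) (hr : m + 2 ≤ r) (hS : S = x + 2 * m + 3) (hx : x + m + 8 + g ≤ 2 * r)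
    (hxl : 1 - m - g ≤ x) : False := by
  have hG := h.toBallotGrid
  -- two consecutive entries of one column cannot vanish together
  have XX : ∀ y z, -g ≤ y → 2 ≤ y → y < z → z + 1 ≤ r → c y z = 0 → c y (z + 1) = 0 → False := by
    intro y z h1 h2 h3 h4 h5 h6
    have := hG.neg_below one_pos hg hm hv (x := y) (y := z + 1) (by omega) h4 (by omega) h1 h6.le
    rw [add_sub_cancel_right, h5] at this
    exact lt_irrefl _ this
  rcases lt_or_ge x (-g) with hlt | hge
  · refine h.false_of_altSource_ne_zero hv hg hm hr hS (by omega) hxl ?_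
    rw [altSource_left hg (by omega) (by omega)]
    norm_num
  rcases hge.eq_or_lt with rfl | hgt
  · refine h.false_of_altSource_ne_zero hv hg hm hr hS (by omega) hxl ?_
    rw [altSource_neg hg]
    linarith
  rcases le_or_gt x (-2) with h0 | h0
  · have T2 := h.eq_mul_altSource hm (x := x + 1) (z := m + 2) (by omega) (by omega)
      (by omega) (by omega) (by omega)
    have T3 := h.eq_mul_altSource hm (x := x + 2) (z := m + 1) (by omega) (by omega)
      (by omega) (by omega) (by omega)
    rw [altSource_gap (by omega) (by omega), mul_zero] at T2 T3
    have := hG.neg_antidiag one_pos hg hm hv (x := x + 1) (y := m + 2) (by omega) hr (by omega)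
      (by omega) T2.le
    rw [show x + 1 + 1 = x + 2 by ring, show m + 2 - 1 = m + 1 by ring, T3] at this
    exact lt_irrefl _ this
  rcases (show -1 ≤ x by omega).eq_or_lt with rfl | h1
  · exact h.false_of_zero_one hv (by omega) hm (z := m + 1) (by omega) (by omega) (by omega)
  rcases (show 0 ≤ x by omega).eq_or_lt with rfl | h1
  · rcases le_or_gt m 3 with h3 | h3
    · exact h.false_of_zero_one hv (by omega) hm (z := m + 2) (by omega) (by omega) (by omega)
    have T2 := h.eq_mul_altSource hm (x := 1) (z := m + 2) (by omega) (by omega)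
      (by omega) (by omega) (by omega)
    have T3 := h.eq_mul_altSource hm (x := 2) (z := m + 1) (by omega) (by omega)
      (by omega) (by omega) (by omega)
    rw [altSource_one] at T2
    rw [altSource_mid le_rfl (by omega), mul_one] at T3
    have hA : 0 < c 1 (m + 2) := by
      by_contra! hc
      have := hG.neg_row one_pos hg hm hv (x := 1) (x' := m) (y := m + 2) (by omega) (by omega)
        hr (by omega) (by omega) (by omega) hc
      nlinarith
    have hK : c m (m + 2) < 0 := by
      by_contra! hc
      nlinarith
    have hB : 0 < c 2 (m + 1) := by
      by_contra! hc
      have b1 := hG.neg_antidiag one_pos hg hm hv (x := 2) (y := m + 1) (by omega) (by omega)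
        (by omega) (by omega) hc
      have s := hG.step 3 (m + 1) (by omega) (by omega) (by omega)
      norm_num at b1 s
      have b2 := hG.antitone_row one_pos hg hm hv (x := 3) (x' := m) (y := m + 1) (by omega)
        (by omega) (by omega) (by omega) (by omega) (by rw [add_sub_cancel_right]; exact b1.le)
      linarith
    have key : ∀ t, 1 ≤ t → t ≤ m → 0 < c t (m + 2) := by
      intro t ht
      induction t, ht using Int.leInduction with
      | base => exact fun _ => hA
      | succ t ht ih =>
        intro htm
        rw [hG.step (t + 1) (m + 2) (by omega) hr (by omega), add_sub_cancel_right,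
          show m + 2 - 1 = m + 1 by ring]
        have : 0 < c (t + 1) (m + 1) := by
          by_contra! hc
          have := hG.nonpos_row one_pos hg hm hv (x := t + 1) (x' := m) (y := m + 1) (by omega)
            (by omega) (by omega) (by omega) (by omega) hc
          linarith
        linarith [ih (by omega)]
    linarith [key m (by omega) le_rfl]
  rcases le_or_gt (x + 2) m with hxm | hxm
  · refine h.false_of_altSource_ne_zero hv hg hm hr hS hxm hxl ?_
    rcases (show 1 ≤ x by omega).eq_or_lt with rfl | h2
    · rw [altSource_one]; exact hv.ne
    · rw [altSource_mid (by omega) (by omega)]; norm_num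
  rcases (show m ≤ x + 1 by omega).eq_or_lt with hxm | hxm
  · obtain rfl : x = m - 1 := by omega
    by_cases hz : altSource g m 1 v (m - 2) = 0
    · by_cases hmg : m = 2 ∧ 1 ≤ g
      · exact h.false_of_zero_one hv hmg.2 hm (z := m + 3) (by omega) (by omega) (by omega)
      · exfalso
        revert hz
        rcases hm.eq_or_lt with rfl | hm
        · obtain rfl : g = 0 := by omega
          have := altSource_neg (g := 0) (m := 2) (u := 1) (v := v) le_rfl
          norm_num at this ⊢
          rw [this]; linarith
        · rcases (show 3 ≤ m by omega).eq_or_lt with rfl | hm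
          · norm_num
            rw [altSource_one]; exact hv.ne
          · rw [altSource_mid (by omega) (by omega)]; norm_num
    · have T1 := h.mul_altSource_eq_zero hm (x := m - 1) (y := m + 1) (z := m + 2) (by omega)
        (by omega) (by omega) (by omega) (by omega) (by omega)
      have T2 := h.mul_altSource_eq_zero hm (x := m - 2) (y := m + 1) (z := m + 2 + 1) (by omega)
        (by omega) (by omega) (by omega) (by omega) (by omega)
      have hne : altSource g m 1 v (m - 1) ≠ 0 := by
        rcases hm.eq_or_lt with rfl | hm
        · norm_num
          rw [altSource_one]; exact hv.ne
        · rw [altSource_mid (by omega) (by omega)]; norm_num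
      exact XX (m + 1) (m + 2) (by omega) (by omega) (by omega) (by omega)
        ((mul_eq_zero.mp T1).resolve_right hne) ((mul_eq_zero.mp T2).resolve_right hz)
  -- split `x + m + 3` into two indices that are as close to each other as possible, so that both
  -- exceed `m` and the larger one, increased by one, does not exceed `r`
  · obtain ⟨y, hy⟩ : ∃ y, y = (x + m + 4) / 2 - 1 := ⟨_, rfl⟩
    have T1 := h.mul_altSource_eq_zero hm (x := m) (y := y)
      (z := x + m + 3 - y) (by omega) (by omega)
      (by omega) (by omega) (by omega) (by omega)
    have T2 := h.mul_altSource_eq_zero hm (x := m - 1) (y := y)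
      (z := x + m + 3 - y + 1) (by omega) (by omega)
      (by omega) (by omega) (by omega) (by omega)
    have hne : altSource g m 1 v (m - 1) ≠ 0 := by
      rcases hm.eq_or_lt with rfl | hm
      · norm_num
        rw [altSource_one]; exact hv.ne
      · rw [altSource_mid (by omega) (by omega)]; norm_num
    rw [altSource_mid hm le_rfl, mul_one] at T1
    exact XX y _ (by omega) (by omega) (by omega) (by omega) T1
      ((mul_eq_zero.mp T2).resolve_right hne)

end Neg

/-- The dichotomy that reduces complex grids to real ones: for `v` off the real line the value of a
real-linear functional at `v` is independent of its value at `1`. -/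
theorem exists_functional_or_neg (v : ℂ) :
    (∃ t : ℝ, t < 0 ∧ v = t) ∨ ∃ f : ℂ →+ ℝ, f 1 = 1 ∧ 0 ≤ f v := by
  by_cases him : v.im = 0
  · rcases lt_or_ge v.re 0 with hre | hre
    · exact .inl ⟨v.re, hre, Complex.ext (by simp) (by simp [him])⟩
    · exact .inr ⟨Complex.reAddGroupHom, by simp, by simpa⟩
  · refine .inr ⟨Complex.reAddGroupHom +
      (AddMonoidHom.mulLeft (-v.re / v.im)).comp Complex.imAddGroupHom, by simp, ?_⟩
    simp [div_mul_cancel₀ _ him]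

/-- The lowest-weight Jacobi identities have no solution with nonzero source. Here `Z + g` is the
first invariant `z₁`, and `r = n - z₂`. The smaller `z₁` is relative to `m`, the fewer rows
are needed: those up to `m`, those up to `m + 1`, or all of them. -/
theorem false_of_complex {v : ℂ} {c : ℤ → ℤ → ℂ} {Z : ℤ} (h : JacobiGrid g m r (Z + m - 1) v c)
    (hg : 0 ≤ g) (hm : 2 ≤ m) (hmr : m ≤ r) (hZ : 4 ≤ Z + g) (hr : r + 3 ≤ Z + g + m)
    (hZr : Z + g + 4 ≤ 2 * r) : False := by
  by_cases h0 : Z + g + 4 ≤ 2 * m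
  · have h' := h.restrict hmr
    rcases exists_functional_or_neg v with ⟨t, ht, rfl⟩ | ⟨f, f1, fv⟩
    · exact h'.re.full_false_of_neg ht (x := Z - m) hg (by ring) (by omega) (by omega) (by omega)
    · exact h'.full_false_of_nonneg f f1 fv (x := Z - m) hg (by ring) (by omega) (by omega)
        (by omega)
  by_cases h1 : Z + g + 2 ≤ 2 * m
  · have h' := h.restrict (r' := m + 1) (by omega)
    rcases exists_functional_or_neg v with ⟨t, ht, rfl⟩ | ⟨f, f1, fv⟩
    · exact h'.re.penultimate_false_of_neg ht (x := Z - m - 2) hg (by ring) (by omega) (by omega)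
        (by omega)
    · exact h'.penultimate_false_of_nonneg f f1 fv (x := Z - m - 2) hg (by ring) (by omega)
        (by omega) (by omega)
  by_cases h2 : m + 2 ≤ r
  · rcases exists_functional_or_neg v with ⟨t, ht, rfl⟩ | ⟨f, f1, fv⟩
    · exact h.re.tall_false_of_neg ht (x := Z - m - 4) hg hm h2 (by ring) (by omega) (by omega)
    · exact h.tall_false_of_nonneg f f1 fv (x := Z - m - 4) hg hm h2 (by ring) (by omega)
        (by omega)
  · omega

end JacobiGrid

/-! ### Grids with a single source -/

namespace BallotGrid

variable {g m r S : ℤ} {v : ℂ} {c : ℤ → ℤ → ℂ}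

/-- Dividing by the source makes a grid with a single source real and positive. -/
theorem exists_real_of_single (h : BallotGrid g r (stepSource m 0 v) c) (hv : v ≠ 0) :
    ∃ f : ℂ →+ ℝ, BallotGrid g r (stepSource m 0 1) (fun x y => f (c x y)) := by
  refine ⟨Complex.reAddGroupHom.comp (AddMonoidHom.mulRight v⁻¹), ?_⟩
  have := h.map (Complex.reAddGroupHom.comp (AddMonoidHom.mulRight v⁻¹))
  simpa [mul_inv_cancel₀ hv] using this

theorem ne_zero_of_single (h : BallotGrid g r (stepSource m 0 v) c) (hv : v ≠ 0) (hg : 0 ≤ g)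
    {x y : ℤ} (hxy : x < y) (hy : y ≤ r) (hy1 : 1 ≤ y) (hx : -g ≤ x) : c x y ≠ 0 := by
  intro h0
  obtain ⟨f, hf⟩ := h.exists_real_of_single hv
  have := hf.pos_of_right le_rfl hg one_pos hxy hy hy1 hx
  simp [h0] at this

theorem altSource_single_zero {x : ℤ} (h1 : x ≠ 1) (h2 : x ≠ -g) :
    altSource g m (0 : ℂ) v x = 0 := by
  simp only [altSource, stepSource]
  split_ifs <;> first | omega | simp

section

variable (h : BallotGrid g r (stepSource m 0 v) c) (hv : v ≠ 0) (hg : 0 ≤ g) (hr : r + 2 ≤ S + g)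
  (jac : ∀ x y z, x < y → y < z → z ≤ r → 1 - g ≤ x + y → x + y + z = S →
    c x y * altSource g m 0 v z + c y z * altSource g m 0 v x - c x z * altSource g m 0 v y = 0)
include h hv hg hr jac

/-- Otherwise the Jacobi identity for `(-g, S + g - r, r)` reduces to the one term
`c (S + g - r) r * v`, which does not vanish. -/
theorem le_of_single (hr2 : 2 ≤ r) : 2 * r ≤ S + g := by
  by_contra! hlt
  have j := jac (-g) (S + g - r) r (by omega) (by omega) le_rfl (by omega) (by omega)
  rw [altSource_neg hg, altSource_single_zero (x := r) (by omega) (by omega),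
    altSource_single_zero (x := S + g - r) (by omega) (by omega), mul_zero, mul_zero, zero_add,
    sub_zero, mul_neg, neg_eq_zero] at j
  exact (mul_ne_zero (h.ne_zero_of_single hv hg (by omega) le_rfl (by omega) (by omega)) hv) j

/-- Otherwise the Jacobi identity for the triple of `1`, `r` and `S - 1 - r`, or for `(1, 2, r - 1)`
if the former triple degenerates, reduces to a single term that does not vanish. -/
theorem lt_of_single (hr4 : 4 ≤ r) : 2 * r < S := by
  have ha := h.le_of_single hv hg hr jac (by omega)
  by_contra! hle
  have one : altSource g m (0 : ℂ) v 1 = v := altSource_one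
  rcases lt_trichotomy (S - 1 - r) 1 with hx | hx | hx
  · have j := jac (S - 1 - r) 1 r hx (by omega) le_rfl (by omega) (by omega)
    rw [altSource_single_zero (x := r) (by omega) (by omega),
      altSource_single_zero (x := S - 1 - r) (by omega) (by omega), one, mul_zero, mul_zero,
      zero_add, zero_sub, neg_eq_zero] at j
    exact (mul_ne_zero (h.ne_zero_of_single hv hg (by omega) le_rfl (by omega) (by omega)) hv) j
  · have j := jac 1 2 (r - 1) (by omega) (by omega) (by omega) (by omega) (by omega)
    rw [altSource_single_zero (x := r - 1) (by omega) (by omega),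
      altSource_single_zero (x := 2) (by omega) (by omega), one, mul_zero, mul_zero,
      zero_add, sub_zero] at j
    exact (mul_ne_zero (h.ne_zero_of_single hv hg (by omega) (by omega) (by omega) (by omega)) hv) j
  · have j := jac 1 (S - 1 - r) r hx (by omega) le_rfl (by omega) (by omega)
    rw [altSource_single_zero (x := r) (by omega) (by omega),
      altSource_single_zero (x := S - 1 - r) (by omega) (by omega), one, mul_zero, mul_zero,
      zero_add, sub_zero] at j
    exact (mul_ne_zero (h.ne_zero_of_single hv hg (by omega) le_rfl (by omega) (by omega)) hv) j

/-- If the lowest weight has the single source `v`, then the mixed Jacobi identities with the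
first later weight that carries a nonzero `γ` (at distance `q - m`) are inconsistent: the
combination of grid entries in the identity for the two top rows is positive. -/
theorem false_of_single (hr4 : 4 ≤ r) {γ : ℂ} (hγ : γ ≠ 0) {q : ℤ} (hmq : m < q) (hqr : q ≤ r)
    (hSr : S + g + 5 ≤ 2 * r + m)
    (mixed : ∀ x y z, 1 + (q - m) ≤ x → 2 ≤ x → x < y → y < z → z ≤ r → x + y + z = S + (q - m) →
      c x y * (if z ≤ q then γ else 0) + c y z * (if x ≤ q then γ else 0) -
        c x z * (if y ≤ q then γ else 0) = 0) : False := by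
  have hS := h.lt_of_single hv hg hr jac hr4
  obtain ⟨f, hf⟩ := h.exists_real_of_single hv
  obtain ⟨x, hx⟩ : ∃ x, x = S + (q - m) - 2 * r + 1 := ⟨_, rfl⟩
  have j := mixed x (r - 1) r (by omega) (by omega) (by omega) (by omega) le_rfl (by omega)
  rw [if_pos (show x ≤ q by omega)] at j
  have p := hf.pred_eq r le_rfl (by omega)
  have s := hf.step (r - 2) r (by omega) le_rfl (by omega)
  have pos := fun x y => hf.pos_of_right (x := x) (y := y) le_rfl hg one_pos
  have mono : f (c x r) ≤ f (c (r - 2 - 1) r) :=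
    hf.mono_row le_rfl zero_le_one (by omega) (by omega) le_rfl (by omega)
  have p1 := pos (r - 2) (r - 1) (by omega) (by omega) (by omega) (by omega)
  have p2 := pos x (r - 1) (by omega) (by omega) (by omega) (by omega)
  have p3 := pos (r - 1) r (by omega) (by omega) (by omega) (by omega)
  split_ifs at j
  · have j' : c x (r - 1) + c (r - 1) r - c x r = 0 :=
      (mul_eq_zero.mp (by linear_combination j :
        (c x (r - 1) + c (r - 1) r - c x r) * γ = 0)).resolve_right hγ
    have := congrArg f j'
    simp only [map_sub, map_add, map_zero] at this
    linarith
  · omega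
  · have j' : c (r - 1) r - c x r = 0 :=
      (mul_eq_zero.mp (by linear_combination j :
        (c (r - 1) r - c x r) * γ = 0)).resolve_right hγ
    have := congrArg f j'
    simp only [map_sub, map_zero] at this
    linarith
  · have j' : c (r - 1) r = 0 :=
      (mul_eq_zero.mp (by linear_combination j : c (r - 1) r * γ = 0)).resolve_right hγ
    rw [j', map_zero] at p3
    exact lt_irrefl _ p3

end

end BallotGrid

/-! ### Structure constants of the family -/

/-- The properties of the structure constants `B i j h`, the coefficient of `e_h` in `[e_i, e_j]`,
of an algebra of the family in an adapted basis. Indices are integers, a basis vector with index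
outside `2, …, n` being read as `0`. The derivation `[e_1, ·]` enters through `step`, and the
condition `β_(k,ℓ) = γ_(k+ℓ-1)` through `gamma`. -/
structure StructureConstants (n z₁ z₂ : ℤ) (B : ℤ → ℤ → ℤ → ℂ) : Prop where
  antisymm : ∀ i j h, B i j h = -B j i h
  step : ∀ i j h, i ≤ n → j ≤ n → 3 ≤ h → B i j h = B (i - 1) j (h - 1) + B i (j - 1) (h - 1)
  top : ∀ i j h, n < i → B i j h = 0
  zero_of_lt : ∀ i j h, i < z₁ → j ≤ n → B i j h = 0
  zero_of_le : ∀ i j h, i ≤ z₂ → j ≤ z₂ → B i j h = 0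
  zero_of_lcs : ∀ i j h, i ≤ n → j ≤ n → i + j - n - 1 < h → B i j h = 0
  jacobi : ∀ i j k, i ≤ n → j ≤ n → k ≤ n →
    ∑ h ∈ Finset.Icc 2 n, B i j h * B h k 2 + ∑ h ∈ Finset.Icc 2 n, B j k h * B h i 2 +
      ∑ h ∈ Finset.Icc 2 n, B k i h * B h j 2 = 0
  exists_one : ∃ h, 2 ≤ h ∧ B z₁ n h ≠ 0
  exists_two : ∃ h, 2 ≤ h ∧ B z₂ (z₂ + 1) h ≠ 0
  gamma : ∀ i j, z₁ ≤ i → i < j → z₂ + 2 ≤ j → j ≤ n → i + j ≤ z₁ + n →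
    B i j 2 = B z₁ (i + j - z₁) 2

namespace StructureConstants

variable {n z₁ z₂ : ℤ} {B : ℤ → ℤ → ℤ → ℂ}

/-- `w` is the lowest weight `i + j` at which `e_2` occurs in some `[e_i, e_j]`. -/
def IsLowestWeight (n : ℤ) (B : ℤ → ℤ → ℤ → ℂ) (w : ℤ) : Prop :=
  (∀ i j, i ≤ n → j ≤ n → i + j < w → B i j 2 = 0) ∧
    ∃ i j, i ≤ n ∧ j ≤ n ∧ i + j = w ∧ B i j 2 ≠ 0

/-- `q` is the first index at which the bracket of `e_{z₁}` with `e_{z₂ + q}` involves `e_2`. The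
coefficient in question is `α_1` for `q = 1` and `γ_(q-1)` for `q ≥ 2`. -/
def IsFirstGamma (z₁ z₂ n : ℤ) (B : ℤ → ℤ → ℤ → ℂ) (q : ℤ) : Prop :=
  1 ≤ q ∧ z₂ + q ≤ n ∧ B z₁ (z₂ + q) 2 ≠ 0 ∧ ∀ p, 1 ≤ p → p < q → B z₁ (z₂ + p) 2 = 0

theorem self_zero (hB : StructureConstants n z₁ z₂ B) (i h : ℤ) : B i i h = 0 :=
  self_eq_neg.mp (hB.antisymm i i h)

theorem exists_isFirstGamma (hB : StructureConstants n z₁ z₂ B) (hz : z₁ ≤ z₂) (hn : z₁ ≤ n) :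
    ∃ q, IsFirstGamma z₁ z₂ n B q := by
  have key : ∀ h, 2 ≤ h → ∀ j, j ≤ n → B z₁ j h ≠ 0 → ∃ i, i ≤ n ∧ B z₁ i 2 ≠ 0 := by
    intro h hh
    induction h, hh using Int.leInduction with
    | base => exact fun j hj hne => ⟨j, hj, hne⟩
    | succ h hh ih =>
      intro j hj hne
      rw [hB.step _ _ _ hn hj (by omega), hB.zero_of_lt _ _ _ (by omega) hj, zero_add,
        add_sub_cancel_right] at hne
      exact ih _ (by omega) hne
  obtain ⟨h, hh, hne⟩ := hB.exists_one
  obtain ⟨i, hi, hne⟩ := key h hh n le_rfl hne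
  have hi2 : z₂ < i := by
    by_contra! hc
    exact hne (hB.zero_of_le _ _ _ hz hc)
  have hex : ∃ p : ℕ, 1 ≤ p ∧ z₂ + p ≤ n ∧ B z₁ (z₂ + p) 2 ≠ 0 :=
    ⟨(i - z₂).toNat, by omega, by omega, by rwa [show z₂ + ((i - z₂).toNat : ℤ) = i by omega]⟩
  classical
  obtain ⟨h1, h2, h3⟩ := Nat.find_spec hex
  refine ⟨Nat.find hex, by exact_mod_cast h1, h2, h3, ?_⟩
  intro p hp hpq
  by_contra hc
  refine Nat.find_min hex (m := p.toNat) (by omega) ⟨by omega, by omega, ?_⟩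
  rwa [show (p.toNat : ℤ) = p by omega]

theorem exists_isLowestWeight (hB : StructureConstants n z₁ z₂ B) (hz : z₁ ≤ z₂) (hn : z₁ ≤ n)
    (hz1 : 2 ≤ z₁) : ∃ w, IsLowestWeight n B w := by
  obtain ⟨q, h1, h2, h3, -⟩ := hB.exists_isFirstGamma hz hn
  have hex : ∃ w : ℕ, ∃ i j, i ≤ n ∧ j ≤ n ∧ i + j = (w : ℤ) ∧ B i j 2 ≠ 0 :=
    ⟨(z₁ + (z₂ + q)).toNat, z₁, z₂ + q, hn, h2, by omega, h3⟩
  classical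
  refine ⟨Nat.find hex, ?_, Nat.find_spec hex⟩
  intro i j hi hj hij
  by_contra hc
  have hi0 : z₁ ≤ i := by
    by_contra! h
    exact hc (hB.zero_of_lt _ _ _ h hj)
  have hj0 : z₁ ≤ j := by
    by_contra! h
    rw [hB.antisymm, hB.zero_of_lt _ _ _ h hi, neg_zero] at hc
    exact hc rfl
  exact Nat.find_min hex (m := (i + j).toNat) (by omega) ⟨i, j, hi, hj, by omega, hc⟩

section LowestWeight

variable {w : ℤ} (hB : StructureConstants n z₁ z₂ B) (hw : IsLowestWeight n B w)
include hB hw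

/-- Away from `h = 2` this follows by applying `[e_1, ·]` repeatedly. -/
theorem zero_of_weight {h : ℤ} (hh : 2 ≤ h) :
    ∀ i j, i ≤ n → j ≤ n → i + j - w + 2 < h → B i j h = 0 := by
  induction h, hh using Int.leInduction with
  | base => exact fun i j hi hj hij => hw.1 i j hi hj (by omega)
  | succ h hh ih =>
    intro i j hi hj hij
    rw [hB.step i j _ hi hj (by omega), add_sub_cancel_right, ih _ _ (by omega) hj (by omega),
      ih _ _ hi (by omega) (by omega), add_zero]

theorem weight_le (hn : z₂ + 1 ≤ n) : w ≤ 2 * z₂ + 1 := by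
  obtain ⟨h, hh, hne⟩ := hB.exists_two
  by_contra! hc
  exact hne (hB.zero_of_weight hw hh _ _ (by omega) hn (by omega))

theorem lt_weight : z₁ + z₂ < w := by
  obtain ⟨i, j, hi, hj, hij, hne⟩ := hw.2
  have hi0 : z₁ ≤ i := by
    by_contra! h
    exact hne (hB.zero_of_lt _ _ _ h hj)
  have hj0 : z₁ ≤ j := by
    by_contra! h
    rw [hB.antisymm, hB.zero_of_lt _ _ _ h hi, neg_zero] at hne
    exact hne rfl
  by_contra! hc
  exact hne (hB.zero_of_le _ _ _ (by omega) (by omega))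

theorem add_three_le_weight : n + 3 ≤ w := by
  obtain ⟨i, j, hi, hj, hij, hne⟩ := hw.2
  by_contra! hc
  exact hne (hB.zero_of_lcs _ _ _ hi hj (by omega))

omit hB in
theorem weight_le_of_isFirstGamma (hn : z₁ ≤ n) {q : ℤ} (hq : IsFirstGamma z₁ z₂ n B q) :
    w ≤ z₁ + z₂ + q := by
  by_contra! hc
  exact hq.2.2.1 (hw.1 _ _ hn hq.2.1 (by omega))

/-- The coefficient of `e_2` in the Jacobi identity, for indices with sum `w + w' - 2`: if no
bracket of `e_i`, `e_j` or `e_k` with another vector of the basis that has weight less than `w'`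
involves `e_2`, then a single term of each of the three iterated brackets contributes. -/
theorem jacobi_weight (w' : ℤ) {i j k : ℤ} (hi : i ≤ n) (hj : j ≤ n) (hk : k ≤ n)
    (hsum : i + j + k = w + w' - 2) (hi' : ∀ h, h ≤ n → h + i < w' → B h i 2 = 0)
    (hj' : ∀ h, h ≤ n → h + j < w' → B h j 2 = 0) (hk' : ∀ h, h ≤ n → h + k < w' → B h k 2 = 0)
    (hz : 2 ≤ z₁) :
    B i j (w' - k) * B (w' - k) k 2 + B j k (w' - i) * B (w' - i) i 2 +
      B k i (w' - j) * B (w' - j) j 2 = 0 := by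
  have single : ∀ i j k : ℤ, i ≤ n → j ≤ n → k ≤ n → i + j + k = w + w' - 2 →
      (∀ h, h ≤ n → h + k < w' → B h k 2 = 0) →
      ∑ h ∈ Finset.Icc 2 n, B i j h * B h k 2 = B i j (w' - k) * B (w' - k) k 2 := by
    intro i j k hi hj hk hsum hk'
    refine Finset.sum_eq_single _ (fun h hh hne => ?_) (fun hout => ?_)
    · rw [Finset.mem_Icc] at hh
      rcases lt_or_ge h (w' - k) with hlt | hge
      · rw [hk' h hh.2 (by omega), mul_zero]
      · rw [hB.zero_of_weight hw hh.1 i j hi hj (by omega), zero_mul]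
    · rw [Finset.mem_Icc, not_and_or, not_le, not_le] at hout
      rcases hout with hout | hout
      · rw [hB.zero_of_lt (w' - k) k 2 (by omega) hk, mul_zero]
      · rw [hB.top _ _ _ hout, mul_zero]
  rw [← single i j k hi hj hk hsum hk', ← single j k i hj hk hi (by omega) hi',
    ← single k i j hk hi hj (by omega) hj']
  exact hB.jacobi i j k hi hj hk

end LowestWeight

section Leading

variable {m g r : ℤ} {u : ℂ} (hB : StructureConstants n z₁ z₂ B)
  (hw : IsLowestWeight n B (z₁ + z₂ + m)) (hg : g = z₂ - z₁ - m + 1) (hr : r = n - z₂)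
  (hmr : m ≤ r) (hm : 1 ≤ m) (hz1 : 4 ≤ z₁) (hg0 : 0 ≤ g)
  (hu : 2 ≤ m → u = B z₁ (z₂ + m) 2)
include hB hg hr hmr hm hu hg0

theorem source_eq {x y : ℤ} (hxy : x < y) (hy : y ≤ r) (hsum : x + y = 1 - g) :
    B (z₂ + x) (z₂ + y) 2 = stepSource m u (B (z₂ - g) (z₂ + 1) 2) y := by
  rw [stepSource]
  split_ifs with h1 h2
  · subst h1
    rw [show z₂ + x = z₂ - g by omega]
  · rw [hB.gamma _ _ (by omega) (by omega) (by omega) (by omega) (by omega), hu (by omega)]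
    congr 1; omega
  · rcases le_or_gt y 0 with hy0 | hy0
    · exact hB.zero_of_le _ _ _ (by omega) (by omega)
    · exact hB.zero_of_lt _ _ _ (by omega) (by omega)

/-- The leading structure constants, the last ones that the lowest weight allows to be nonzero,
form a ballot grid. -/
theorem ballotGrid : BallotGrid g r (stepSource m u (B (z₂ - g) (z₂ + 1) 2))
    (fun x y => B (z₂ + x) (z₂ + y) (x + y + g + 1)) where
  diag x := hB.self_zero _ _
  step x y hxy hy hN := by
    rw [hB.step _ _ _ (by omega) (by omega) (by omega)]
    congr 2 <;> ring
  init x y hxy hy hN := by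
    rw [show x + y + g + 1 = 2 by omega]
    exact hB.source_eq hg hr hmr hm hg0 hu hxy hy hN

theorem altSource_eq {x : ℤ} (hx : x ≤ r) :
    B (z₂ + (1 - g - x)) (z₂ + x) 2 = altSource g m u (B (z₂ - g) (z₂ + 1) 2) x := by
  rw [altSource]
  split_ifs with h1
  · exact hB.source_eq hg hr hmr hm hg0 hu (by omega) hx (by omega)
  · rcases lt_or_ge (-g) x with h3 | h3
    · rw [stepSource, if_neg (by omega), if_neg (by omega),
        hB.zero_of_le _ _ _ (by omega) (by omega), neg_zero]
    rcases le_or_gt (1 - g - x) r with h2 | h2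
    · rw [hB.antisymm, hB.source_eq hg hr hmr hm hg0 hu (x := x) (y := 1 - g - x) (by omega) h2
        (by omega)]
    · rw [stepSource, if_neg (by omega), if_neg (by omega),
        hB.top (z₂ + (1 - g - x)) _ _ (by omega), neg_zero]

include hw hz1 in
/-- `jacobi_weight` with both brackets of lowest weight. -/
theorem jacobi_leading {x y z : ℤ} (hx : x ≤ r) (hy : y ≤ r) (hz : z ≤ r)
    (hS : x + y + z = z₁ + m - 1 - g) :
    let c := fun x y => B (z₂ + x) (z₂ + y) (x + y + g + 1)
    let v := B (z₂ - g) (z₂ + 1) 2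
    c x y * altSource g m u v z + c y z * altSource g m u v x - c x z * altSource g m u v y =
      0 := by
  intro c v
  have j := hB.jacobi_weight hw (z₁ + z₂ + m) (i := z₂ + x) (j := z₂ + y) (k := z₂ + z) (by omega)
    (by omega) (by omega) (by omega) (fun h h1 h2 => hw.1 _ _ h1 (by omega) h2)
    (fun h h1 h2 => hw.1 _ _ h1 (by omega) h2) (fun h h1 h2 => hw.1 _ _ h1 (by omega) h2)
    (by omega)
  rw [hB.antisymm (z₂ + z) (z₂ + x),
    show z₁ + z₂ + m - (z₂ + z) = z₂ + (1 - g - z) by omega,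
    show z₁ + z₂ + m - (z₂ + x) = z₂ + (1 - g - x) by omega,
    show z₁ + z₂ + m - (z₂ + y) = z₂ + (1 - g - y) by omega,
    hB.altSource_eq hg hr hmr hm hg0 hu hx, hB.altSource_eq hg hr hmr hm hg0 hu hy,
    hB.altSource_eq hg hr hmr hm hg0 hu hz,
    show z₂ + (1 - g - z) = x + y + g + 1 by omega,
    show z₂ + (1 - g - x) = y + z + g + 1 by omega,
    show z₂ + (1 - g - y) = x + z + g + 1 by omega] at j
  linear_combination j

end Leading

variable {m : ℤ}

/-- If the first nonzero `γ` occurs in the lowest weight, the lowest-weight Jacobi identities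
cannot hold. -/
theorem false_of_gamma_leading (hB : StructureConstants n z₁ z₂ B)
    (hw : IsLowestWeight n B (z₁ + z₂ + m)) (hn : z₂ + 1 ≤ n) (hm : 2 ≤ m) (hmr : z₂ + m ≤ n)
    (hz1 : 4 ≤ z₁) (hne : B z₁ (z₂ + m) 2 ≠ 0) (hsmall : z₁ + 4 ≤ 2 * (n - z₂)) : False := by
  obtain ⟨g, hg⟩ : ∃ g, g = z₂ - z₁ - m + 1 := ⟨_, rfl⟩
  obtain ⟨u, hu⟩ : ∃ u, u = B z₁ (z₂ + m) 2 := ⟨_, rfl⟩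
  have hg0 : 0 ≤ g := by have := hB.weight_le hw hn; omega
  have h3 := hB.add_three_le_weight hw
  have grid := hB.ballotGrid hg rfl (by omega) (by omega) hg0 (fun _ => hu)
  have jac := fun x y z => hB.jacobi_leading hw hg rfl (by omega) (by omega) hz1 hg0 (fun _ => hu)
    (x := x) (y := y) (z := z)
  rw [← hu] at hne
  simp only at jac
  generalize B (z₂ - g) (z₂ + 1) 2 = v at grid jac
  have grid' := grid.map (AddMonoidHom.mulRight u⁻¹)
  simp only [AddMonoidHom.coe_mulRight, mul_inv_cancel₀ hne] at grid'
  have hs : ∀ x, altSource g m 1 (v * u⁻¹) x = altSource g m u v x * u⁻¹ := by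
    intro x
    simp only [altSource, stepSource]
    split_ifs <;> simp [hne]
  refine JacobiGrid.false_of_complex (m := m) (g := g) (r := n - z₂) (Z := z₁ - g)
    ⟨grid', ?_⟩ hg0 hm (by omega) (by omega) (by omega) (by omega)
  intro x y z h1 h2 hz h4 h5
  have := jac x y z (by omega) (by omega) hz (by omega)
  rw [hs, hs, hs]
  linear_combination (u⁻¹ * u⁻¹) * this

/-- If no `γ` occurs in the lowest weight, then `z₁` is large. The grid of leading constants has
a single source in this case. For `m = 1` the Jacobi identities in lowest weight suffice;
otherwise they are supplemented by those that involve the first `γ` different from zero. -/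
theorem false_of_gamma_later (hB : StructureConstants n z₁ z₂ B)
    (hw : IsLowestWeight n B (z₁ + z₂ + m)) (hn : z₂ + 2 ≤ n) (hm : 1 ≤ m) (hmr : z₂ + m ≤ n)
    (hz1 : 4 ≤ z₁) (h0 : 2 ≤ m → B z₁ (z₂ + m) 2 = 0)
    (hsmall : z₁ + 4 ≤ 2 * (n - z₂) ∨ m = 1 ∧ z₁ + 3 ≤ 2 * (n - z₂)) : False := by
  obtain ⟨g, hg⟩ : ∃ g, g = z₂ - z₁ - m + 1 := ⟨_, rfl⟩
  obtain ⟨r, hr⟩ : ∃ r, r = n - z₂ := ⟨_, rfl⟩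
  have hg0 : 0 ≤ g := by have := hB.weight_le hw (by omega); omega
  have h3 := hB.add_three_le_weight hw
  have hu : 2 ≤ m → (0 : ℂ) = B z₁ (z₂ + m) 2 := fun h => (h0 h).symm
  have grid := hB.ballotGrid hg hr (by omega) (by omega) hg0 hu
  have jac : ∀ x y z, x < y → y < z → z ≤ r → 1 - g ≤ x + y → x + y + z = z₁ + m - 1 - g → _ :=
    fun x y z h1 h2 h3 _ h5 => hB.jacobi_leading hw hg hr (by omega) (by omega) hz1 hg0 hu
      (x := x) (y := y) (z := z) (by omega) (by omega) h3 h5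
  have hv : B (z₂ - g) (z₂ + 1) 2 ≠ 0 := by
    intro hv
    obtain ⟨i, j, hi, hj, hij, hne⟩ := hw.2
    have key : ∀ i j, i ≤ n → j ≤ n → i + j = z₁ + z₂ + m → i < j → B i j 2 = 0 := by
      intro i j hi hj hij hlt
      have := hB.source_eq hg hr (by omega) (by omega) hg0 hu (x := i - z₂) (y := j - z₂) (by omega)
        (by omega) (by omega)
      rw [show z₂ + (i - z₂) = i by ring, show z₂ + (j - z₂) = j by ring, hv] at this
      rw [this, stepSource]
      split_ifs <;> rfl
    rcases lt_trichotomy i j with h | h | h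
    · exact hne (key i j hi hj hij h)
    · subst h; exact hne (hB.self_zero _ _)
    · rw [hB.antisymm, key j i hj hi (by omega) h, neg_zero] at hne
      exact hne rfl
  simp only at jac
  have hle := grid.le_of_single hv hg0 (S := z₁ + m - 1 - g) (by omega) jac (by omega)
  by_cases hm1 : m = 1
  · omega
  have hsmall : z₁ + 4 ≤ 2 * (n - z₂) := by omega
  obtain ⟨q, hq⟩ := hB.exists_isFirstGamma (by omega) (by omega)
  have hmq := weight_le_of_isFirstGamma hw (by omega) hq
  have hmq' : m < q := by
    rcases (show m ≤ q by omega).eq_or_lt with h | h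
    · exact absurd (h0 (by omega)) (h ▸ hq.2.2.1)
    · exact h
  obtain ⟨hq1, hqn, hqne, hqmin⟩ := hq
  refine grid.false_of_single hv hg0 (S := z₁ + m - 1 - g) (by omega) jac (by omega)
    hqne hmq' (by omega) (by omega) ?_
  -- brackets of weight below `z₁ + z₂ + q` with a factor of index at least `z₂ + 2` do not
  -- involve `e_2`
  have vanish : ∀ k, z₂ + 2 ≤ k → k ≤ n → ∀ h, h ≤ n → h + k < z₁ + z₂ + q → B h k 2 = 0 := by
    have small : ∀ i j, z₁ ≤ i → i < j → z₂ + 2 ≤ j → j ≤ n → i + j < z₁ + z₂ + q →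
        B i j 2 = 0 := by
      intro i j h1 h2 h3 h4 h5
      rw [hB.gamma i j h1 h2 h3 h4 (by omega),
        show i + j - z₁ = z₂ + (i + j - z₁ - z₂) by ring]
      exact hqmin _ (by omega) (by omega)
    intro k hk hkn h hh hlt
    rcases lt_or_ge h z₁ with h1 | h1
    · exact hB.zero_of_lt _ _ _ h1 hkn
    rcases lt_trichotomy h k with h2 | h2 | h2
    · exact small h k h1 h2 hk hkn hlt
    · subst h2; exact hB.self_zero _ _
    · rw [hB.antisymm, small k h (by omega) h2 (by omega) hh (by omega), neg_zero]
  have value : ∀ x, 1 + (q - m) ≤ x → 2 ≤ x → x ≤ r →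
      B (z₁ + z₂ + q - (z₂ + x)) (z₂ + x) 2 = if x ≤ q then B z₁ (z₂ + q) 2 else 0 := by
    intro x h1 h2 h3
    split_ifs with hx
    · rw [hB.gamma _ _ (by omega) (by omega) (by omega) (by omega) (by omega)]
      congr 1; ring
    · exact hB.zero_of_lt _ _ _ (by omega) (by omega)
  intro x y z hx hx2 hxy hyz hz hS
  have j := hB.jacobi_weight hw (z₁ + z₂ + q) (i := z₂ + x) (j := z₂ + y) (k := z₂ + z) (by omega)
    (by omega) (by omega) (by omega) (vanish _ (by omega) (by omega))
    (vanish _ (by omega) (by omega)) (vanish _ (by omega) (by omega)) (by omega)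
  rw [hB.antisymm (z₂ + z) (z₂ + x), value x hx hx2 (by omega), value y (by omega) (by omega)
    (by omega), value z (by omega) (by omega) hz,
    show z₁ + z₂ + q - (z₂ + z) = x + y + g + 1 by omega,
    show z₁ + z₂ + q - (z₂ + x) = y + z + g + 1 by omega,
    show z₁ + z₂ + q - (z₂ + y) = x + z + g + 1 by omega] at j
  linear_combination j

/-- The lowest weight is written as `z₁ + z₂ + m`, with `m` in the range where the condition on `β`
determines the coefficients of `e_2`. -/
theorem exists_weight (hB : StructureConstants n z₁ z₂ B) (hz : z₁ ≤ z₂) (hn : z₂ + 1 ≤ n)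
    (hz1 : 4 ≤ z₁) : ∃ m, 1 ≤ m ∧ z₂ + m ≤ n ∧ IsLowestWeight n B (z₁ + z₂ + m) := by
  obtain ⟨w, hw⟩ := hB.exists_isLowestWeight hz (by omega) (by omega)
  obtain ⟨q, hq⟩ := hB.exists_isFirstGamma hz (by omega)
  have h1 := weight_le_of_isFirstGamma hw (by omega) hq
  have h2 := hB.lt_weight hw
  exact ⟨w - z₁ - z₂, by omega, by have := hq.2.1; omega,
    by rwa [show z₁ + z₂ + (w - z₁ - z₂) = w by ring]⟩

/-- The statement behind part (2): the family is empty when `z₁` is small. -/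
theorem false_of_le (hB : StructureConstants n z₁ z₂ B) (hz : z₁ ≤ z₂) (hn : z₂ + 1 ≤ n)
    (hz1 : 4 ≤ z₁) (hsmall : z₁ + 4 ≤ 2 * (n - z₂)) : False := by
  obtain ⟨m, hm, hmr, hw⟩ := hB.exists_weight hz hn hz1
  by_cases h : 2 ≤ m ∧ B z₁ (z₂ + m) 2 ≠ 0
  · exact hB.false_of_gamma_leading hw hn h.1 hmr hz1 h.2 hsmall
  · exact hB.false_of_gamma_later hw (by omega) hm hmr hz1
      (fun h2 => by_contra fun h3 => h ⟨h2, h3⟩) (.inl hsmall)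

/-- The brackets of the `e_i` with `i < n` lie in the span of `e_2, …, e_{z₂}`, which is abelian. -/
theorem zero_of_lt_of_lt (hB : StructureConstants n z₁ z₂ B) (hz : z₁ ≤ z₂) (hn : z₂ + 2 ≤ n)
    (hz1 : 4 ≤ z₁) {i j h : ℤ} (hi : i < n) (hj : j < n) (hh : z₂ < h) : B i j h = 0 := by
  obtain ⟨m, hm, hmr, hw⟩ := hB.exists_weight hz (by omega) hz1
  have h1 : ¬ z₁ + 4 ≤ 2 * (n - z₂) := fun h => hB.false_of_le hz (by omega) hz1 h
  have h2 : ¬ (m = 1 ∧ z₁ + 3 ≤ 2 * (n - z₂)) := fun h =>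
    hB.false_of_gamma_later hw hn hm hmr hz1 (fun h2 => absurd h2 (by omega)) (.inr h)
  rcases lt_trichotomy i j with hij | rfl | hij
  · exact hB.zero_of_weight hw (by omega) i j (by omega) (by omega) (by omega)
  · exact hB.self_zero _ _
  · exact hB.zero_of_weight hw (by omega) i j (by omega) (by omega) (by omega)

end StructureConstants

/-! ### From the Lie algebra to its structure constants -/

section Basis

variable {𝔤 : Type*} [LieRing 𝔤] [LieAlgebra ℂ 𝔤] {n : ℕ} (b : Module.Basis (Fin n) ℂ 𝔤)

/-- The basis vector `e_i` for `2 ≤ i ≤ n`, and `0` for every other integer `i`. With this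
convention `[e_1, e_i] = e_{i-1}` for all `i ≤ n`. -/
noncomputable def vec (i : ℤ) : 𝔤 := if 2 ≤ i then basisVec b i.toNat else 0

/-- The coordinate functional belonging to `vec b h`. -/
noncomputable def crd (h : ℤ) : 𝔤 →ₗ[ℂ] ℂ := if 2 ≤ h then coordFun b h.toNat else 0

theorem crd_two : crd b 2 = coordFun b 2 := if_pos le_rfl

theorem basisVec_of_gt {i : ℕ} (hi : n < i) : basisVec b i = 0 := dif_neg (by omega)

theorem vec_of_gt {i : ℤ} (hi : n < i) : vec b i = 0 := by
  rw [vec]; split_ifs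
  · exact basisVec_of_gt b (by omega)
  · rfl

theorem vec_of_lt {i : ℤ} (hi : i < 2) : vec b i = 0 := if_neg (by omega)

theorem vec_natCast {i : ℕ} (hi : 2 ≤ i) : vec b i = basisVec b i := by
  rw [vec, if_pos (by omega), Int.toNat_natCast]

theorem coordFun_basisVec (h i : ℕ) :
    coordFun b h (basisVec b i) = if h = i ∧ 1 ≤ i ∧ i ≤ n then 1 else 0 := by
  by_cases hi : 1 ≤ i ∧ i ≤ n
  · by_cases hh : 1 ≤ h ∧ h ≤ n
    · rw [coordFun, dif_pos hh, basisVec, dif_pos hi, Module.Basis.coord_apply,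
        Module.Basis.repr_self, Finsupp.single_apply]
      congr 1
      simp only [Fin.mk.injEq, eq_iff_iff]
      omega
    · rw [coordFun, dif_neg hh, if_neg (by omega)]; rfl
  · rw [basisVec, dif_neg hi, map_zero, if_neg (by omega)]

theorem crd_vec (h i : ℤ) : crd b h (vec b i) = if h = i ∧ 2 ≤ i ∧ i ≤ n then 1 else 0 := by
  by_cases hi : 2 ≤ i
  · by_cases hh : 2 ≤ h
    · rw [crd, if_pos hh, vec, if_pos hi, coordFun_basisVec]
      congr 1
      simp only [eq_iff_iff]
      omega
    · rw [crd, if_neg hh, if_neg (by omega)]; rfl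
  · rw [vec_of_lt b (by omega), map_zero, if_neg (by omega)]

theorem crd_basisVec_one (h : ℤ) : crd b h (basisVec b 1) = 0 := by
  rw [crd]; split_ifs with hh
  · rw [coordFun_basisVec, if_neg (by omega)]
  · rfl

theorem coordFun_one_vec (i : ℤ) : coordFun b 1 (vec b i) = 0 := by
  rw [vec]; split_ifs
  · rw [coordFun_basisVec, if_neg (by omega)]
  · simp

theorem linearMap_ext {W : Type*} [AddCommGroup W] [Module ℂ W] {f f' : 𝔤 →ₗ[ℂ] W}
    (h1 : f (basisVec b 1) = f' (basisVec b 1))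
    (h2 : ∀ i : ℤ, 2 ≤ i → i ≤ n → f (vec b i) = f' (vec b i)) : f = f' := by
  refine b.ext fun k => ?_
  have hk : b k = basisVec b (k + 1) := by
    rw [basisVec, dif_pos ⟨by omega, k.2⟩]; congr
  rw [hk]
  rcases Nat.eq_zero_or_pos (k : ℕ) with h0 | h0
  · rw [h0]; exact h1
  · have := h2 ((k + 1 : ℕ) : ℤ) (by omega) (by omega)
    rwa [vec_natCast b (by omega)] at this

theorem expansion (v : 𝔤) :
    v = coordFun b 1 v • basisVec b 1 + ∑ h ∈ Finset.Icc (2 : ℤ) n, crd b h v • vec b h := by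
  have : (LinearMap.id : 𝔤 →ₗ[ℂ] 𝔤) = (coordFun b 1).smulRight (basisVec b 1) +
      ∑ h ∈ Finset.Icc (2 : ℤ) n, (crd b h).smulRight (vec b h) := by
    refine linearMap_ext b ?_ ?_
    · simp only [LinearMap.id_apply, LinearMap.add_apply, LinearMap.smulRight_apply,
        LinearMap.sum_apply, crd_basisVec_one, zero_smul, Finset.sum_const_zero, add_zero]
      by_cases hn : 1 ≤ n
      · rw [coordFun_basisVec, if_pos ⟨rfl, le_rfl, hn⟩, one_smul]
      · rw [basisVec_of_gt b (by omega), smul_zero]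
    · intro i hi hin
      simp only [LinearMap.id_apply, LinearMap.add_apply, LinearMap.smulRight_apply,
        LinearMap.sum_apply, coordFun_one_vec, zero_smul, zero_add]
      rw [Finset.sum_eq_single i]
      · rw [crd_vec, if_pos ⟨rfl, hi, hin⟩, one_smul]
      · intro h _ hne
        rw [crd_vec, if_neg (by tauto), zero_smul]
      · intro hout
        exact absurd (Finset.mem_Icc.mpr ⟨hi, hin⟩) hout
  simpa using congrArg (fun f => f v) this

/-- The span of `e_2, …, e_k`, described by its equations. -/
noncomputable def flag (k : ℤ) : Submodule ℂ 𝔤 :=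
  LinearMap.ker (coordFun b 1) ⊓ ⨅ h : {h : ℤ // k < h}, LinearMap.ker (crd b h)

variable {b}

theorem mem_flag {k : ℤ} {v : 𝔤} :
    v ∈ flag b k ↔ coordFun b 1 v = 0 ∧ ∀ h, k < h → crd b h v = 0 := by
  simp [flag, Submodule.mem_iInf]

theorem vec_mem_flag {i k : ℤ} (h : i ≤ k) : vec b i ∈ flag b k :=
  mem_flag.mpr ⟨coordFun_one_vec b i, fun h' hk => by rw [crd_vec, if_neg (by omega)]⟩

theorem eq_sum_of_mem_flag {k : ℤ} {v : 𝔤} (hv : v ∈ flag b k) :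
    v = ∑ h ∈ Finset.Icc (2 : ℤ) n, crd b h v • vec b h := by
  conv_lhs => rw [expansion b v, (mem_flag.mp hv).1, zero_smul, zero_add]

theorem flag_le {k : ℤ} {N : Submodule ℂ 𝔤} (h : ∀ i : ℤ, i ≤ k → i ≤ n → vec b i ∈ N) :
    flag b k ≤ N := by
  intro v hv
  rw [eq_sum_of_mem_flag hv]
  refine Submodule.sum_mem _ fun i hi => ?_
  rcases le_or_gt i k with hik | hik
  · exact N.smul_mem _ (h i hik (Finset.mem_Icc.mp hi).2)
  · rw [(mem_flag.mp hv).2 i hik, zero_smul]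
    exact N.zero_mem

theorem eq_zero_of_mem_flag {v : 𝔤} {k : ℤ} (hv : v ∈ flag b k)
    (h : ∀ h : ℤ, 2 ≤ h → crd b h v = 0) : v = 0 := by
  rw [eq_sum_of_mem_flag hv]
  exact Finset.sum_eq_zero fun i hi => by rw [h i (Finset.mem_Icc.mp hi).1, zero_smul]

theorem le_finrank_flag (hF : FiniteDimensional ℂ 𝔤) {k : ℕ} (hk : k ≤ n) :
    k - 1 ≤ Module.finrank ℂ (flag b k) := by
  let w : Fin (k - 1) → 𝔤 := fun i => b ⟨i + 1, by omega⟩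
  have hw : LinearIndependent ℂ w :=
    b.linearIndependent.comp (fun i : Fin (k - 1) => (⟨i + 1, by omega⟩ : Fin n)) (by
      intro i j hij
      simp only [Fin.mk.injEq, add_left_inj] at hij
      exact Fin.ext hij)
  have hspan : Submodule.span ℂ (Set.range w) ≤ flag b k := by
    rw [Submodule.span_le]
    rintro _ ⟨i, rfl⟩
    have : w i = vec b ((i + 2 : ℕ) : ℤ) := by
      rw [vec_natCast b (by omega), basisVec, dif_pos ⟨by omega, by omega⟩]
      rfl
    rw [this]
    exact vec_mem_flag (by omega)
  calc k - 1 = Module.finrank ℂ (Submodule.span ℂ (Set.range w)) := by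
        rw [finrank_span_eq_card hw, Fintype.card_fin]
    _ ≤ _ := Submodule.finrank_mono hspan

end Basis

section Adapted

variable {𝔤 : Type*} [LieRing 𝔤] [LieAlgebra ℂ 𝔤] {n : ℕ} {b : Module.Basis (Fin n) ℂ 𝔤}

theorem lie_one_vec (hA : IsAdapted b) (hn : 1 ≤ n) {i : ℤ} (hi : i ≤ n) :
    ⁅basisVec b 1, vec b i⁆ = vec b (i - 1) := by
  rcases lt_or_ge i 2 with h | h
  · rw [vec_of_lt b h, vec_of_lt b (by omega), lie_zero]
  lift i to ℕ using by omega
  rcases h.eq_or_lt with h | h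
  · obtain rfl : i = 2 := by omega
    rw [vec_of_lt b (i := ((2 : ℕ) : ℤ) - 1) (by norm_num), vec_natCast b le_rfl, ← lie_skew,
      hA.bracket_two 1 le_rfl hn, neg_zero]
  · rw [vec_natCast b (by omega), hA.bracket_one i (by omega) (by omega),
      show (i : ℤ) - 1 = ((i - 1 : ℕ) : ℤ) by omega, vec_natCast b (by omega)]

theorem crd_lie_one (hA : IsAdapted b) (hn : 1 ≤ n) {h : ℤ} (hh : 3 ≤ h) (v : 𝔤) :
    crd b (h - 1) ⁅basisVec b 1, v⁆ = crd b h v := by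
  have : crd b (h - 1) ∘ₗ (LieAlgebra.ad ℂ 𝔤 (basisVec b 1) : 𝔤 →ₗ[ℂ] 𝔤) = crd b h := by
    refine linearMap_ext b ?_ ?_
    · simp [crd_basisVec_one]
    · intro i hi hin
      simp only [LinearMap.comp_apply, LieAlgebra.ad_apply]
      rw [lie_one_vec hA hn hin, crd_vec, crd_vec]
      congr 1
      simp only [eq_iff_iff]
      omega
  simpa using congrArg (fun f => f v) this

theorem vec_mem_lowerCentralSeries (hA : IsAdapted b) (hn : 1 ≤ n) (k : ℕ) {i : ℤ}
    (hi : i ≤ n - k) : vec b i ∈ LieModule.lowerCentralSeries ℂ 𝔤 𝔤 k := by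
  induction k generalizing i with
  | zero => simp
  | succ k ih =>
    rw [LieModule.lowerCentralSeries_succ]
    have := lie_one_vec hA hn (i := i + 1) (by push_cast at hi; omega)
    rw [add_sub_cancel_right] at this
    rw [← this]
    exact LieSubmodule.lie_mem_lie (LieSubmodule.mem_top _) (ih (by push_cast at hi; omega))

/-- In an adapted basis the descending central series is the flag of the spans of
`e_2, …, e_{n-k}`. -/
theorem lowerCentralSeries_eq_flag (hF : IsFiliform 𝔤 n) (hA : IsAdapted b) {k : ℕ} (hk : 1 ≤ k)
    (hkn : k + 1 ≤ n) :
    (LieModule.lowerCentralSeries ℂ 𝔤 𝔤 k : Submodule ℂ 𝔤) = flag b (n - k) := by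
  have := hF.finite
  symm
  refine Submodule.eq_of_le_of_finrank_le
    (flag_le fun i hi _ => vec_mem_lowerCentralSeries hA (by omega) k hi) ?_
  have h1 := hF.finrank_descCentral (k + 1) (by omega) hkn
  have h2 := le_finrank_flag (b := b) hF.finite (k := n - k) (by omega)
  rw [descCentral, add_tsub_cancel_right] at h1
  rw [show (n : ℤ) - k = ((n - k : ℕ) : ℤ) by omega]
  refine le_trans (le_of_eq h1) (le_trans (by omega) h2)

theorem lie_mem_flag (hF : IsFiliform 𝔤 n) (hA : IsAdapted b) (hn : 2 ≤ n) (x y : 𝔤) :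
    ⁅x, y⁆ ∈ flag b (n - 1) := by
  have := lowerCentralSeries_eq_flag hF hA (k := 1) le_rfl hn
  push_cast at this
  rw [← this]
  change _ ∈ LieModule.lowerCentralSeries ℂ 𝔤 𝔤 1
  rw [LieModule.lowerCentralSeries_succ]
  exact LieSubmodule.lie_mem_lie (LieSubmodule.mem_top _) (LieSubmodule.mem_top _)

theorem lie_one_lie (x y : 𝔤) :
    ⁅⁅basisVec b 1, x⁆, y⁆ = ⁅basisVec b 1, ⁅x, y⁆⁆ - ⁅x, ⁅basisVec b 1, y⁆⁆ := by
  rw [lie_lie]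

/-- `[e_i, e_j]` has no component at `e_h` for `h > i + j - n - 1`. For `i = n` this is the
inclusion `[𝔤, C^k 𝔤] ⊆ C^(k+1) 𝔤`; the other cases follow by applying `[e_1, ·]`, here
with `i = n - t`. -/
theorem crd_lie_vec_eq_zero (hF : IsFiliform 𝔤 n) (hA : IsAdapted b) (hn : 2 ≤ n) (t : ℕ) :
    ∀ {j h : ℤ}, j ≤ n → n - t + j - n - 1 < h → 2 ≤ h →
      crd b h ⁅vec b (n - t), vec b j⁆ = 0 := by
  induction t with
  | zero =>
    intro j h hj hlt hh
    rcases lt_or_ge j 2 with hj2 | hj2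
    · rw [vec_of_lt b hj2, lie_zero, map_zero]
    have hmem : ⁅vec b ((n : ℤ) - (0 : ℕ)), vec b j⁆ ∈ flag b (n - ((n - j).toNat + 1 : ℕ)) := by
      rw [← lowerCentralSeries_eq_flag hF hA (by omega) (by omega)]
      change _ ∈ LieModule.lowerCentralSeries ℂ 𝔤 𝔤 _
      rw [LieModule.lowerCentralSeries_succ]
      exact LieSubmodule.lie_mem_lie (LieSubmodule.mem_top _)
        (vec_mem_lowerCentralSeries hA (by omega) _ (by omega))
    exact (mem_flag.mp hmem).2 h (by omega)
  | succ t ih =>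
    intro j h hj hlt hh
    push_cast at hlt ⊢
    have h1 := lie_one_vec hA (by omega) (i := n - t) (by omega)
    rw [show (n : ℤ) - (t + 1) = n - t - 1 by ring, ← h1, lie_one_lie, map_sub,
      lie_one_vec hA (by omega) hj, ih (by omega) (by omega) hh, sub_zero]
    have := crd_lie_one hA (by omega) (h := h + 1) (by omega) ⁅vec b (n - t), vec b j⁆
    rw [add_sub_cancel_right] at this
    rw [this, ih hj (by omega) (by omega)]

/-- The minimality of `z₁` concerns `[e_i, e_n]` only; `[e_1, ·]` carries it to smaller second
indices `n - t`. -/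
theorem vec_lie_vec_eq_zero_of_lt {z₁ z₂ : ℕ} (hA : IsAdapted b) (hT : HasTriple b z₁ z₂) (t : ℕ) :
    ∀ {i : ℤ}, i < z₁ → ⁅vec b i, vec b (n - t)⁆ = 0 := by
  obtain ⟨⟨h4, hzn, -⟩, hmin⟩ := hT.isLeast_one
  induction t with
  | zero =>
    intro i hi
    rcases lt_or_ge i 2 with h | h
    · rw [vec_of_lt b h, zero_lie]
    lift i to ℕ using by omega
    rw [Nat.cast_zero, sub_zero, vec_natCast b (by omega), vec_natCast b (by omega)]
    rcases (show i = 2 ∨ i = 3 ∨ 4 ≤ i by omega) with rfl | rfl | h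
    · exact hA.bracket_two n (by omega) le_rfl
    · exact hA.bracket_three n (by omega) le_rfl
    · by_contra hne
      exact absurd (hmin ⟨h, by omega, hne⟩) (by omega)
  | succ t ih =>
    intro i hi
    have h1 := lie_one_vec hA (by omega) (i := (n : ℤ) - t) (by omega)
    rw [Nat.cast_succ, ← sub_sub, ← h1]
    have h2 := lie_one_lie (b := b) (vec b i) (vec b (n - t))
    rw [lie_one_vec hA (by omega) (by omega), ih hi, ih (by omega), lie_zero, zero_sub] at h2
    exact neg_eq_zero.mp h2.symm

/-- The minimality of `z₂` concerns neighbouring indices only; `[e_1, ·]` carries it to pairs at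
any distance `d`. -/
theorem vec_lie_vec_eq_zero_of_le {z₁ z₂ : ℕ} (hA : IsAdapted b) (hT : HasTriple b z₁ z₂) (d : ℕ) :
    ∀ {i : ℤ}, i + d ≤ z₂ → ⁅vec b i, vec b (i + d)⁆ = 0 := by
  obtain ⟨⟨h4, hzn, -⟩, hmin⟩ := hT.isLeast_two
  induction d using Nat.strong_induction_on with
  | _ d ih =>
    intro i hi
    rcases lt_or_ge i 2 with h | h
    · rw [vec_of_lt b h, zero_lie]
    match d, ih with
    | 0, _ => rw [Nat.cast_zero, add_zero, lie_self]
    | 1, _ =>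
      lift i to ℕ using by omega
      rw [show (i : ℤ) + (1 : ℕ) = ((i + 1 : ℕ) : ℤ) by push_cast; rfl, vec_natCast b (by omega),
        vec_natCast b (by omega)]
      rcases (show i = 2 ∨ i = 3 ∨ 4 ≤ i by omega) with rfl | rfl | h
      · exact hA.bracket_two _ (by omega) (by omega)
      · exact hA.bracket_three _ (by omega) (by omega)
      · by_contra hne
        exact absurd (hmin ⟨h, by omega, hne⟩) (by push_cast at hi; omega)
    | d + 2, ih =>
      push_cast at hi ⊢
      have h1 := lie_one_vec hA (by omega) (i := i + 1) (by omega)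
      rw [add_sub_cancel_right] at h1
      have e1 := ih (d + 1) (by omega) (i := i + 1) (by push_cast; omega)
      have e2 := ih d (by omega) (i := i + 1) (by omega)
      push_cast at e1
      rw [← h1, lie_one_lie, lie_one_vec hA (by omega) (by omega),
        show i + ((d : ℤ) + 2) = i + 1 + (d + 1) by ring, e1,
        show i + 1 + ((d : ℤ) + 1) - 1 = i + 1 + d by ring, e2, lie_zero, sub_zero]

theorem crd_two_law_gamma {z₁ z₂ : ℕ} {α γ : ℕ → ℂ} {β : ℕ → ℕ → ℂ} (hL : HasLaw b z₁ z₂ α β γ)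
    (hz : 2 ≤ z₁) (hz2 : 2 ≤ z₂) {j : ℕ} (hj : 2 ≤ j) (hjn : z₂ + j ≤ n) :
    crd b 2 ⁅vec b z₁, vec b (z₂ + j : ℕ)⁆ = γ (j - 1) := by
  rw [vec_natCast b hz, vec_natCast b (by omega), hL.law_gamma j hj hjn, crd_two]
  simp only [map_add, map_smul, map_sum, coordFun_basisVec, smul_eq_mul]
  rw [if_neg (by omega), mul_zero, zero_add, Finset.sum_eq_single (j - 1)]
  · rw [if_pos (by omega), mul_one]
  · intro s hs hne
    rw [Finset.mem_Icc] at hs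
    rw [if_neg (by omega), mul_zero]
  · intro hout
    exact absurd (Finset.mem_Icc.mpr ⟨by omega, le_rfl⟩) hout

theorem crd_two_law_beta {z₁ z₂ : ℕ} {α γ : ℕ → ℂ} {β : ℕ → ℕ → ℂ} (hL : HasLaw b z₁ z₂ α β γ)
    (hz : 2 ≤ z₁) (hz2 : 2 ≤ z₂) {k l : ℕ} (hl : 2 ≤ l) (hln : z₂ + l ≤ n) (hk : 1 ≤ k)
    (hkl : z₁ + k < z₂ + l) :
    crd b 2 ⁅vec b (z₁ + k : ℕ), vec b (z₂ + l : ℕ)⁆ = β k l := by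
  rw [vec_natCast b (by omega), vec_natCast b (by omega), hL.law_beta k l hl hln hk hkl,
    crd_two]
  simp only [map_add, map_smul, map_sum, coordFun_basisVec, smul_eq_mul]
  have eone : (if True ∧ 1 ≤ 2 ∧ 2 ≤ n then (1 : ℂ) else 0) = 1 :=
    if_pos ⟨trivial, one_le_two, by omega⟩
  rw [eone, mul_one, add_eq_right]
  refine Finset.sum_eq_zero fun h hh => ?_
  rw [Finset.mem_Icc] at hh
  rw [if_neg (by omega), mul_zero]

theorem triple_le {z₁ z₂ : ℕ} (hA : IsAdapted b) (hT : HasTriple b z₁ z₂) : z₁ ≤ z₂ := by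
  obtain ⟨⟨h4, hzn, hne⟩, -⟩ := hT.isLeast_two
  by_contra! hlt
  have := vec_lie_vec_eq_zero_of_lt hA hT (n - (z₂ + 1)) (i := z₂) (by omega)
  rw [show (n : ℤ) - (n - (z₂ + 1) : ℕ) = ((z₂ + 1 : ℕ) : ℤ) by omega, vec_natCast b (by omega),
    vec_natCast b (by omega)] at this
  exact hne this

theorem exists_crd_ne_zero (hF : IsFiliform 𝔤 n) (hA : IsAdapted b) (hn : 2 ≤ n) {x y : 𝔤}
    (h : ⁅x, y⁆ ≠ 0) : ∃ h : ℤ, 2 ≤ h ∧ crd b h ⁅x, y⁆ ≠ 0 := by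
  by_contra! hc
  exact h (eq_zero_of_mem_flag (lie_mem_flag hF hA hn x y) hc)

theorem structureConstants {z₁ z₂ : ℕ} {α γ : ℕ → ℂ} {β : ℕ → ℕ → ℂ} (hF : IsFiliform 𝔤 n)
    (hA : IsAdapted b) (hT : HasTriple b z₁ z₂) (hL : HasLaw b z₁ z₂ α β γ)
    (hβ : ∀ k l, 2 ≤ l → z₂ + l ≤ n → 1 ≤ k → z₁ + k < z₂ + l → z₂ + k + l ≤ n →
      β k l = γ (k + l - 1)) :
    StructureConstants n z₁ z₂ (fun i j h => crd b h ⁅vec b i, vec b j⁆) := by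
  obtain ⟨h4, hzn, hne1⟩ := hT.isLeast_one.1
  obtain ⟨h4', hzn', hne2⟩ := hT.isLeast_two.1
  have hn : 1 ≤ n := by omega
  have zero_of_lt : ∀ i j h : ℤ, i < z₁ → j ≤ n → crd b h ⁅vec b i, vec b j⁆ = 0 := by
    intro i j h hi hj
    have := vec_lie_vec_eq_zero_of_lt hA hT (n - j).toNat hi
    rw [show (n : ℤ) - (n - j).toNat = j by omega] at this
    rw [this, map_zero]
  have zero_of_le : ∀ i j h : ℤ, i ≤ j → j ≤ z₂ → crd b h ⁅vec b i, vec b j⁆ = 0 := by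
    intro i j h hij hj
    have := vec_lie_vec_eq_zero_of_le hA hT (j - i).toNat (i := i) (by omega)
    rw [show i + (j - i).toNat = j by omega] at this
    rw [this, map_zero]
  have skew : ∀ i j h : ℤ, crd b h ⁅vec b i, vec b j⁆ = -crd b h ⁅vec b j, vec b i⁆ := by
    intro i j h
    rw [← lie_skew, map_neg]
  refine ⟨skew, ?_, ?_, zero_of_lt, ?_, ?_, ?_, ?_, ?_, ?_⟩
  · intro i j h hi hj hh
    rw [← crd_lie_one hA hn hh, ← lie_one_vec hA hn hi, ← lie_one_vec hA hn hj, lie_one_lie,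
      ← map_add, sub_add_cancel]
  · intro i j h hi
    rw [vec_of_gt b hi, zero_lie, map_zero]
  · intro i j h hi hj
    rcases le_total i j with hij | hij
    · exact zero_of_le i j h hij hj
    · rw [skew, zero_of_le j i h hij hi, neg_zero]
  · intro i j h hi hj hh
    rcases lt_or_ge h 2 with h2 | h2
    · rw [crd, if_neg (by omega)]; rfl
    · have := crd_lie_vec_eq_zero hF hA (by omega) (n - i).toNat (j := j) (h := h) hj (by omega) h2
      rwa [show (n : ℤ) - (n - i).toNat = i by omega] at this
  · intro i j k hi hj hk
    have expand : ∀ i j k : ℤ, ∑ h ∈ Finset.Icc (2 : ℤ) n, crd b h ⁅vec b i, vec b j⁆ *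
        crd b 2 ⁅vec b h, vec b k⁆ = crd b 2 ⁅⁅vec b i, vec b j⁆, vec b k⁆ := by
      intro i j k
      conv_rhs => rw [eq_sum_of_mem_flag (lie_mem_flag hF hA (by omega) (vec b i) (vec b j))]
      rw [sum_lie, map_sum]
      exact Finset.sum_congr rfl fun h _ => by rw [smul_lie, map_smul, smul_eq_mul]
    simp only [expand]
    rw [← map_add, ← map_add]
    have cyc : ∀ x y z : 𝔤, ⁅⁅x, y⁆, z⁆ + ⁅⁅y, z⁆, x⁆ + ⁅⁅z, x⁆, y⁆ = 0 := by
      intro x y z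
      have h := lie_jacobi z x y
      rw [← lie_skew ⁅x, y⁆ z, ← lie_skew ⁅y, z⁆ x, ← lie_skew ⁅z, x⁆ y, ← neg_add, ← neg_add, h,
        neg_zero]
    rw [cyc, map_zero]
  · have : ⁅vec b z₁, vec b (n : ℤ)⁆ ≠ 0 := by
      rwa [vec_natCast b (by omega), vec_natCast b (by omega)]
    exact exists_crd_ne_zero hF hA (by omega) this
  · have : ⁅vec b z₂, vec b ((z₂ : ℤ) + 1)⁆ ≠ 0 := by
      rwa [show (z₂ : ℤ) + 1 = ((z₂ + 1 : ℕ) : ℤ) by push_cast; rfl, vec_natCast b (by omega),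
        vec_natCast b (by omega)]
    exact exists_crd_ne_zero hF hA (by omega) this
  · intro i j hi hij hj hjn hijn
    obtain ⟨k, rfl⟩ : ∃ k : ℕ, i = (z₁ + k : ℕ) := ⟨(i - z₁).toNat, by omega⟩
    obtain ⟨l, rfl⟩ : ∃ l : ℕ, j = (z₂ + l : ℕ) := ⟨(j - z₂).toNat, by omega⟩
    have e := crd_two_law_gamma hL (by omega) (by omega) (j := k + l) (by omega) (by omega)
    rw [show ((z₁ + k : ℕ) : ℤ) + (z₂ + l : ℕ) - z₁ = (z₂ + (k + l) : ℕ) by push_cast; ring, e]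
    rcases Nat.eq_zero_or_pos k with rfl | hk
    · rw [zero_add] at e ⊢
      exact e
    · rw [crd_two_law_beta hL (by omega) (by omega) (by omega) (by omega) hk (by omega)]
      exact hβ k l (by omega) (by omega) hk (by omega) (by omega)

/-! ### The derived series -/

theorem lie_mem_of_mem_flag {k k' : ℤ} {N : Submodule ℂ 𝔤}
    (h : ∀ i j : ℤ, i ≤ k → i ≤ n → j ≤ k' → j ≤ n → ⁅vec b i, vec b j⁆ ∈ N) {x y : 𝔤}
    (hx : x ∈ flag b k) (hy : y ∈ flag b k') : ⁅x, y⁆ ∈ N := by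
  have h1 : ∀ i : ℤ, i ≤ k → i ≤ n → flag b k' ≤ N.comap (LieAlgebra.ad ℂ 𝔤 (vec b i)) :=
    fun i hi hin => flag_le fun j hj hjn => h i j hi hin hj hjn
  have h2 : flag b k ≤ N.comap (LieAlgebra.ad ℂ 𝔤 y) := flag_le fun i hi hin => by
    have := h1 i hi hin hy
    simp only [Submodule.mem_comap, LieAlgebra.ad_apply] at this ⊢
    rw [← lie_skew]
    exact N.neg_mem this
  have := h2 hx
  simp only [Submodule.mem_comap, LieAlgebra.ad_apply] at this
  rw [← lie_skew]
  exact N.neg_mem this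

theorem derivedSeries_succ_le {k : ℕ} {N P : Submodule ℂ 𝔤}
    (hN : (LieAlgebra.derivedSeries ℂ 𝔤 k).toSubmodule ≤ N)
    (h : ∀ x ∈ N, ∀ y ∈ N, ⁅x, y⁆ ∈ P) :
    (LieAlgebra.derivedSeries ℂ 𝔤 (k + 1)).toSubmodule ≤ P := by
  rw [LieAlgebra.derivedSeries_def, LieAlgebra.derivedSeriesOfIdeal_succ,
    LieSubmodule.lieIdeal_oper_eq_linear_span', Submodule.span_le]
  rintro _ ⟨x, hx, y, hy, rfl⟩
  exact h x (hN hx) y (hN hy)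

end Adapted

/-- The second derived algebra lies in the span of `e_2, …, e_{z₂}`, which is abelian. The first
derived algebra is spanned by `e_2, …, e_{n-1}`, which makes the lower bounds visible. -/
theorem derivedLength_of_mem {𝔤 : Type*} [LieRing 𝔤] [LieAlgebra ℂ 𝔤] {z₁ z₂ n : ℕ}
    (h : MemFamilyAlphaGamma 𝔤 z₁ z₂ n) :
    LieAlgebra.derivedSeries ℂ 𝔤 3 = ⊥ ∧ (z₂ + 1 = n → LieAlgebra.derivedLength ℂ 𝔤 = 2) ∧
      (z₂ + 1 ≠ n → LieAlgebra.derivedLength ℂ 𝔤 = 3) := by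
  obtain ⟨hF, -, b, hA, hT, α, β, γ, hL, hβ⟩ := h
  obtain ⟨h4, -, -⟩ := hT.isLeast_one.1
  obtain ⟨h4', hzn, hne⟩ := hT.isLeast_two.1
  have hB := structureConstants hF hA hT hL hβ
  have hz := triple_le hA hT
  have toBot : ∀ k, (LieAlgebra.derivedSeries ℂ 𝔤 k).toSubmodule ≤ ⊥ →
      LieAlgebra.derivedSeries ℂ 𝔤 k = ⊥ := fun k hk => by
    rwa [eq_bot_iff]
  have D1 : (LieAlgebra.derivedSeries ℂ 𝔤 1).toSubmodule ≤ flag b (n - 1) :=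
    derivedSeries_succ_le (k := 0) le_top fun x _ y _ => lie_mem_flag hF hA (by omega) x y
  have lie_mem : ∀ {k l : ℤ}, (∀ i j h : ℤ, i ≤ k → j ≤ k → l < h →
      crd b h ⁅vec b i, vec b j⁆ = 0) → ∀ x ∈ flag b k, ∀ y ∈ flag b k, ⁅x, y⁆ ∈ flag b l := by
    intro k l hk x hx y hy
    refine lie_mem_of_mem_flag (fun i j hi _ hj _ => ?_) hx hy
    exact mem_flag.mpr ⟨(mem_flag.mp (lie_mem_flag hF hA (by omega) _ _)).1,
      fun h hh => hk i j h hi hj hh⟩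
  have flag_bot : flag b 1 ≤ ⊥ := fun v hv =>
    eq_zero_of_mem_flag hv fun h hh => (mem_flag.mp hv).2 h (by omega)
  have mem_D1 : ∀ i : ℤ, i < n → vec b i ∈ LieAlgebra.derivedSeries ℂ 𝔤 1 := by
    intro i hi
    have := lie_one_vec hA (by omega) (i := i + 1) (by omega)
    rw [add_sub_cancel_right] at this
    rw [← this]
    exact LieSubmodule.lie_mem_lie (LieSubmodule.mem_top _) (LieSubmodule.mem_top _)
  have step_zero : ∀ k, (LieAlgebra.derivedSeries ℂ 𝔤 k).toSubmodule ≤ flag b z₂ →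
      LieAlgebra.derivedSeries ℂ 𝔤 (k + 1) = ⊥ := by
    intro k hk
    refine toBot _ ((derivedSeries_succ_le hk (P := flag b 1) (lie_mem ?_)).trans flag_bot)
    exact fun i j h hi hj _ => hB.zero_of_le i j h hi hj
  have length : ∀ k, LieAlgebra.derivedSeries ℂ 𝔤 (k + 1) = ⊥ →
      LieAlgebra.derivedSeries ℂ 𝔤 k ≠ ⊥ → LieAlgebra.derivedLength ℂ 𝔤 = k + 1 := by
    intro k h1 h2
    rw [LieAlgebra.derivedSeries_of_derivedLength_succ, LieAlgebra.abelian_iff_derived_succ_eq_bot]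
    exact ⟨h1, h2⟩
  by_cases hzn' : z₂ + 1 = n
  · have h2 : LieAlgebra.derivedSeries ℂ 𝔤 2 = ⊥ :=
      step_zero 1 (by rwa [show (z₂ : ℤ) = n - 1 by omega])
    refine ⟨?_, fun _ => length 1 h2 ?_, fun h => absurd hzn' h⟩
    · rw [eq_bot_iff, ← h2]
      exact LieAlgebra.derivedSeriesOfIdeal_antitone _ (by norm_num)
    · intro h1
      have := mem_D1 2 (by omega)
      rw [h1, LieSubmodule.mem_bot] at this
      have e := crd_vec b 2 2
      rw [this, map_zero, if_pos ⟨rfl, le_rfl, by omega⟩] at e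
      exact zero_ne_one e
  · have D2 : (LieAlgebra.derivedSeries ℂ 𝔤 2).toSubmodule ≤ flag b z₂ :=
      derivedSeries_succ_le D1 (lie_mem fun i j h hi hj hh =>
        hB.zero_of_lt_of_lt (by omega) (by omega) (by omega) (by omega) (by omega) hh)
    have h3 := step_zero 2 D2
    refine ⟨h3, fun h => absurd h hzn', fun _ => length 2 h3 fun h2 => hne ?_⟩
    have hmem : ⁅vec b z₂, vec b ((z₂ + 1 : ℕ) : ℤ)⁆ ∈ LieAlgebra.derivedSeries ℂ 𝔤 2 :=
      LieSubmodule.lie_mem_lie (mem_D1 _ (by omega)) (mem_D1 _ (by omega))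
    rwa [h2, LieSubmodule.mem_bot, vec_natCast b (by omega), vec_natCast b (by omega)] at hmem

end FiliformLie

theorem mainTheorem1 (𝔤 : Type*) [LieRing 𝔤] [LieAlgebra ℂ 𝔤] (z₁ z₂ n : ℕ) :
    (FiliformLie.MemFamilyAlphaGamma 𝔤 z₁ z₂ n →
      LieAlgebra.IsSolvable 𝔤 ∧
      LieAlgebra.derivedLength ℂ 𝔤 ≤ 3 ∧
      (z₂ + 1 = n → LieAlgebra.derivedLength ℂ 𝔤 = 2) ∧
      (z₂ + 1 ≠ n → LieAlgebra.derivedLength ℂ 𝔤 = 3)) ∧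
    (4 ≤ z₁ → z₁ + 4 ≤ 2 * (n - z₂) → z₂ + 3 ≤ n →
      ¬ FiliformLie.MemFamilyAlphaGamma 𝔤 z₁ z₂ n) := by
  refine ⟨fun h => ?_, fun h1 h2 h3 h => ?_⟩
  · obtain ⟨d3, l2, l3⟩ := FiliformLie.derivedLength_of_mem h
    refine ⟨LieAlgebra.IsSolvable.mk d3, Nat.sInf_le d3, l2, l3⟩
  · obtain ⟨hF, -, b, hA, hT, α, β, γ, hL, hβ⟩ := h
    have hz := FiliformLie.triple_le hA hT
    exact (FiliformLie.structureConstants hF hA hT hL hβ).false_of_le (by omega) (by omega)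
      (by omega) (by omega)
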